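/- For $q\in(1,2]$, a $q$-expansion of a real number $x$ is a sequence $(d_i)_{i\ge1}\in\{0,1\}^{\mathbb N}$ with $x=\sum_{i=1}^\infty d_iq^{-i}$. For $x>0$ let $\mathscr U(x)$ be the set of all bases $q\in(1,2]$ in which $x$ has exactly one $q$-expansion, let $q_s(x):=\inf\mathscr U(x)$, and for real $q$ let $L(q):=\{x>0: q_s(x)=q\}$. Let $\tau_i\in\{0,1\}$ be the parity of the number of ones in the binary representation of $i$ (the Thue–Morse sequence), and let $q_{KL}\approx1.787$ be the Komornik–Loreti constant, that is, the unique $q\in(1,2)$ with $\sum_{i=1}^\infty\tau_iq^{-i}=1$. A real number $x$ is a right (left) accumulation point of a set $A\subseteq\mathbb R$ if for every $\varepsilon>0$ the set $A$ meets $(x,x+\varepsilon)$ (respectively $(x-\varepsilon,x)$). **Theorem.** There are infinitely many $x>0$ such that $\mathscr U(x)$ has a smallest element and $q_s(x)=\min\mathscr U(x)=q_{KL}$. Moreover, the level set $L(q_{KL})$ has infinitely many right accumulation points that belong to $L(q_{KL})$, and infinitely many left accumulation points that belong to $L(q_{KL})$. -/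

import Mathlib

namespace UnivoqueBases

/-- `d₀ d₁ d₂ …` is an expansion of `x` in base `q` with digits in `{0, 1}`, i.e.
`x = d₀ / q + d₁ / q² + d₂ / q³ + …`. -/
def IsExpansion (q x : ℝ) (d : ℕ → Fin 2) : Prop :=
  HasSum (fun i : ℕ => ((d i : ℕ) : ℝ) / q ^ (i + 1)) x

/-- The set `𝒰(x)` of all bases `q ∈ (1, 2]` in which `x` has a unique expansion with digits
in `{0, 1}`. -/
def univoqueBases (x : ℝ) : Set ℝ :=
  {q | 1 < q ∧ q ≤ 2 ∧ ∃! d : ℕ → Fin 2, IsExpansion q x d}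

/-- `q_s(x) = inf 𝒰(x)`. -/
noncomputable def qs (x : ℝ) : ℝ := sInf (univoqueBases x)

/-- The level set `L(q) = {x > 0 : q_s(x) = q}`. -/
def levelSet (q : ℝ) : Set ℝ := {x | 0 < x ∧ qs x = q}

/-- The Thue-Morse sequence `τ₀ τ₁ τ₂ …`: the number of ones in the binary representation of `i`,
modulo 2. -/
def thueMorse (i : ℕ) : Fin 2 :=
  ⟨(Nat.digits 2 i).count 1 % 2, Nat.mod_lt _ Nat.two_pos⟩

/-- `q` is a root in `(1, 2)` of the equation `1 = τ₁ / q + τ₂ / q² + τ₃ / q³ + …`. -/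
def IsKomornikLoretiRoot (q : ℝ) : Prop :=
  1 < q ∧ q < 2 ∧ IsExpansion q 1 (fun i => thueMorse (i + 1))

theorem digit_le_one (a : Fin 2) : ((a : ℕ) : ℝ) ≤ 1 := by
  exact_mod_cast (by omega : (a : ℕ) ≤ 1)

theorem digit_term_nonneg {q : ℝ} (hq : 1 < q) (d : ℕ → Fin 2) (i : ℕ) :
    0 ≤ ((d i : ℕ) : ℝ) / q ^ (i + 1) := by positivity

theorem digit_term_le {r q : ℝ} (hr : 1 < r) (hq : r ≤ q) (d : ℕ → Fin 2) (i : ℕ) :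
    ((d i : ℕ) : ℝ) / q ^ (i + 1) ≤ r⁻¹ ^ (i + 1) := by
  have h0 : (0 : ℝ) < r := by linarith
  rw [inv_pow, ← one_div]
  have := digit_le_one (d i)
  gcongr

theorem summable_geometric_succ {r : ℝ} (hr : 1 < r) :
    Summable (fun i : ℕ => r⁻¹ ^ (i + 1)) :=
  (summable_nat_add_iff (f := fun i : ℕ => r⁻¹ ^ i) 1).2
    (summable_geometric_of_lt_one (by positivity) (inv_lt_one_of_one_lt₀ hr))

theorem summable_digits {q : ℝ} (hq : 1 < q) (d : ℕ → Fin 2) :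
    Summable (fun i : ℕ => ((d i : ℕ) : ℝ) / q ^ (i + 1)) :=
  Summable.of_nonneg_of_le (digit_term_nonneg hq d) (digit_term_le hq le_rfl d)
    (summable_geometric_succ hq)

/-- The equation `1 = τ₁ / q + τ₂ / q² + τ₃ / q³ + …` has exactly one root in `(1, 2)`. -/
theorem existsUnique_komornikLoretiRoot : ∃! q : ℝ, IsKomornikLoretiRoot q := by
  set d : ℕ → Fin 2 := fun i => thueMorse (i + 1) with hd
  set f : ℝ → ℝ := fun q => ∑' i : ℕ, ((d i : ℕ) : ℝ) / q ^ (i + 1) with hf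
  have d0 : d 0 = 1 := by simp [hd, thueMorse]
  have d1 : d 1 = 1 := by simp [hd, thueMorse]
  have d2 : d 2 = 0 := by simp [hd, thueMorse]
  have hanti : ∀ p q : ℝ, 1 < p → p < q → f q < f p := by
    intro p q hp hpq
    have hp0 : 0 < p := by linarith
    refine Summable.tsum_lt_tsum (i := 0) (fun i => ?_) ?_ (summable_digits (hp.trans hpq) d)
      (summable_digits hp d)
    · dsimp only
      gcongr
    · rw [d0]
      simpa using inv_strictAnti₀ hp0 hpq
  have hcont : ContinuousOn f (Set.Icc (3 / 2) 2) := by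
    refine continuousOn_tsum (u := fun i : ℕ => (3 / 2 : ℝ)⁻¹ ^ (i + 1)) (fun i => ?_)
      (summable_geometric_succ (by norm_num)) (fun i q hq => ?_)
    · refine ContinuousOn.div continuousOn_const (by fun_prop) (fun q hq => ?_)
      have : (0 : ℝ) < q := by linarith [hq.1]
      positivity
    · rw [Real.norm_of_nonneg (digit_term_nonneg (by linarith [hq.1]) d i)]
      exact digit_term_le (by norm_num) hq.1 d i
  have hleft : 1 < f (3 / 2) := by
    have := (summable_digits (q := 3 / 2) (by norm_num) d).sum_le_tsum (Finset.range 2)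
      (fun i _ => digit_term_nonneg (by norm_num) d i)
    rw [Finset.sum_range_succ, Finset.sum_range_one, d0, d1] at this
    refine lt_of_lt_of_le ?_ this
    norm_num
  have hright : f 2 < 1 := by
    have h1 : ∑' i : ℕ, (2 : ℝ)⁻¹ ^ (i + 1) = 1 := by
      have h := tsum_geometric_two
      have h2 : Summable (fun i : ℕ => (1 / 2 : ℝ) ^ i) := summable_geometric_two
      simp_rw [pow_succ, tsum_mul_right, ← one_div, h]
      norm_num
    rw [← h1]
    refine Summable.tsum_lt_tsum (i := 2) (fun i => digit_term_le (by norm_num) le_rfl d i) ?_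
      (summable_digits (by norm_num) d) (summable_geometric_succ (by norm_num))
    rw [d2]
    norm_num
  obtain ⟨q, hq, hfq⟩ := intermediate_value_Icc' (by norm_num) hcont ⟨hright.le, hleft.le⟩
  have hq1 : 1 < q := by linarith [hq.1]
  have hq2 : q < 2 := by
    refine lt_of_le_of_ne hq.2 ?_
    rintro rfl
    exact hright.ne hfq
  refine ⟨q, ⟨hq1, hq2, ?_⟩, ?_⟩
  · have := (summable_digits hq1 d).hasSum
    rwa [show (∑' i : ℕ, ((d i : ℕ) : ℝ) / q ^ (i + 1)) = 1 from hfq] at this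
  · rintro p ⟨hp1, -, hp⟩
    have hfp : f p = 1 := hp.tsum_eq
    rcases lt_trichotomy p q with h | h | h
    · exact absurd (hanti p q hp1 h) (by rw [hfp, hfq]; exact lt_irrefl _)
    · exact h
    · exact absurd (hanti q p hq1 h) (by rw [hfp, hfq]; exact lt_irrefl _)

/-- The Komornik-Loreti constant `q_KL`, the unique root in `(1, 2)` of the equation
`1 = τ₁ / q + τ₂ / q² + τ₃ / q³ + …`. -/
noncomputable def qKL : ℝ := existsUnique_komornikLoretiRoot.choose

theorem qKL_spec : IsKomornikLoretiRoot qKL := existsUnique_komornikLoretiRoot.choose_spec.1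

/-- `x` is a right accumulation point of `A`: points of `A` approach `x` strictly from the
right. -/
def IsRightAccPt (x : ℝ) (A : Set ℝ) : Prop :=
  ∀ ε > 0, ∃ y ∈ A, x < y ∧ y < x + ε

/-- `x` is a left accumulation point of `A`: points of `A` approach `x` strictly from the
left. -/
def IsLeftAccPt (x : ℝ) (A : Set ℝ) : Prop :=
  ∀ ε > 0, ∃ y ∈ A, x - ε < y ∧ y < x

end UnivoqueBases

namespace UnivoqueBases

/-! Write p for `qKL` and τ for the Thue–Morse sequence. A base q in (1,2] is univoque for x exactly
when x has an `Admissible` expansion in base q (`mem_univoqueBases_iff`), and admissibility survives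
an increase of the base. The examples are the values in base p of `glue k n t`, where t is either
the tail of τ from 2^m on, with m ≥ n, or the complement of τ. Since τ_{2^j+i} = 1 - τ_i for i <
2^j, these tails agree with the complement of τ on ever longer prefixes, and their values `tailVal
m` decrease strictly to `tailLim`.

If t is a tail of τ, the glued sequence d is admissible in base p by `tail_bounds`. No base q < p is
univoque for its value x (`qKL_le_of_mem_univoqueBases`): let an admissible e represent x in base q
and leave d first at i. The hard case is d_i = 1, e_i = 0. There i ends a stretch of d made of a 1
and complemented digits of τ, so admissibility of e either contradicts q < p or forces
τ_1…τ_{2^(j+1)} to have value below 1 in base q. As d arises from τ by deleting digits, the latter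
limits how much the partial values of d grow when the base drops from p to q (`partialVal_sub_le`),
and e then falls short of x. Hence p is the minimum.

If t is the complement of τ, the value is the limit from the right of the previous ones as m grows.
Raising the base slightly makes one of those sequences represent it, so its infimum is still p, and
it is a right accumulation point of the level set. As n grows, these values approach `tailVal k`
from the left. -/

/-! ### Values of digit sequences in a base. -/

/-- The value of the digit sequence `d` in base `q`. -/
noncomputable def val (q : ℝ) (d : ℕ → Fin 2) : ℝ := ∑' i : ℕ, ((d i : ℕ) : ℝ) / q ^ (i + 1)

/-- The value in base `q` of the first `n` digits of `d`. -/
noncomputable def partialVal (q : ℝ) (d : ℕ → Fin 2) (n : ℕ) : ℝ :=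
  ∑ i ∈ Finset.range n, ((d i : ℕ) : ℝ) / q ^ (i + 1)

/-- The sequence `d` with its first `n` digits removed. -/
def drop (n : ℕ) (d : ℕ → Fin 2) : ℕ → Fin 2 := fun i => d (n + i)

/-- The digitwise complement of `d`. -/
def compl (d : ℕ → Fin 2) : ℕ → Fin 2 := fun i => 1 - d i

theorem drop_drop (m n : ℕ) (d : ℕ → Fin 2) : drop m (drop n d) = drop (n + m) d := by
  funext i; simp [drop, add_assoc]

theorem drop_compl (n : ℕ) (d : ℕ → Fin 2) : drop n (compl d) = compl (drop n d) := rfl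

theorem fin_two_cases (a : Fin 2) : a = 0 ∨ a = 1 := by omega

theorem cast_one_sub (a : Fin 2) : (((1 - a : Fin 2) : ℕ) : ℝ) = 1 - ((a : ℕ) : ℝ) := by
  rcases fin_two_cases a with rfl | rfl <;> simp

theorem isExpansion_iff {q x : ℝ} (hq : 1 < q) {d : ℕ → Fin 2} :
    IsExpansion q x d ↔ val q d = x :=
  ⟨fun h => h.tsum_eq, fun h => h ▸ (summable_digits hq d).hasSum⟩

theorem val_nonneg {q : ℝ} (hq : 1 < q) (d : ℕ → Fin 2) : 0 ≤ val q d :=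
  tsum_nonneg (digit_term_nonneg hq d)

theorem val_eq_partialVal_add {q : ℝ} (hq : 1 < q) (d : ℕ → Fin 2) (n : ℕ) :
    val q d = partialVal q d n + val q (drop n d) / q ^ n := by
  have hq0 : (0 : ℝ) < q := by linarith
  rw [val, ← (summable_digits hq d).sum_add_tsum_nat_add n, partialVal, val, ← tsum_div_const]
  congr 1
  refine tsum_congr fun i => ?_
  rw [drop, div_div, ← pow_add, add_comm i n]
  congr 2
  ring

theorem val_eq_head_add {q : ℝ} (hq : 1 < q) (d : ℕ → Fin 2) :
    val q d = (((d 0 : ℕ) : ℝ) + val q (drop 1 d)) / q := by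
  rw [val_eq_partialVal_add hq d 1]
  simp [partialVal, add_div]

theorem val_drop_eq {q : ℝ} (hq : 1 < q) (d : ℕ → Fin 2) (n : ℕ) :
    val q (drop n d) = (((d n : ℕ) : ℝ) + val q (drop (n + 1) d)) / q := by
  rw [val_eq_head_add hq, drop_drop]
  rfl

theorem tsum_inv_pow_succ {q : ℝ} (hq : 1 < q) : ∑' i : ℕ, q⁻¹ ^ (i + 1) = 1 / (q - 1) := by
  have h1 : q⁻¹ < 1 := inv_lt_one_of_one_lt₀ hq
  simp_rw [pow_succ, tsum_mul_right]
  rw [tsum_geometric_of_lt_one (by positivity) h1]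
  have : q - 1 ≠ 0 := by linarith
  have : (1 - q⁻¹) ≠ 0 := by linarith
  field_simp

theorem val_compl {q : ℝ} (hq : 1 < q) (d : ℕ → Fin 2) :
    val q (compl d) = 1 / (q - 1) - val q d := by
  rw [← tsum_inv_pow_succ hq, val, val,
    ← (summable_geometric_succ hq).tsum_sub (summable_digits hq d)]
  refine tsum_congr fun i => ?_
  rw [compl, cast_one_sub, sub_div, one_div, inv_pow]

theorem val_le {q : ℝ} (hq : 1 < q) (d : ℕ → Fin 2) : val q d ≤ 1 / (q - 1) := by
  have := val_nonneg hq (compl d)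
  rw [val_compl hq] at this
  linarith

theorem partialVal_anti {p q : ℝ} (hq : 1 < q) (hpq : q ≤ p) (d : ℕ → Fin 2) (n : ℕ) :
    partialVal p d n ≤ partialVal q d n := by
  refine Finset.sum_le_sum fun i _ => ?_
  have hq0 : (0 : ℝ) < q := by linarith
  gcongr

theorem val_anti {p q : ℝ} (hq : 1 < q) (hpq : q ≤ p) (d : ℕ → Fin 2) : val p d ≤ val q d := by
  refine (summable_digits (hq.trans_le hpq) d).tsum_le_tsum (fun i => ?_) (summable_digits hq d)
  have hq0 : (0 : ℝ) < q := by linarith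
  gcongr

/-- The leading digit alone provides the gap; the other digits only help. -/
theorem val_lt_of_base_lt {p q : ℝ} (hq : 1 < q) (hpq : q < p) {d : ℕ → Fin 2} (h0 : d 0 = 1) :
    val p d + (1 / q - 1 / p) ≤ val q d := by
  rw [val_eq_partialVal_add hq d 1, val_eq_partialVal_add (hq.trans hpq) d 1]
  have h := val_anti hq hpq.le (drop 1 d)
  have h1 := val_nonneg (hq.trans hpq) (drop 1 d)
  have hq0 : (0 : ℝ) < q := by linarith
  simp only [partialVal, Finset.sum_range_one, h0, Fin.val_one, Nat.cast_one, zero_add, pow_one]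
  have h2 := val_nonneg hq (drop 1 d)
  have : val p (drop 1 d) / p ≤ val q (drop 1 d) / q := by gcongr
  linarith

theorem continuousOn_val {r : ℝ} (hr : 1 < r) (d : ℕ → Fin 2) (s : ℝ) :
    ContinuousOn (fun q => val q d) (Set.Icc r s) := by
  refine continuousOn_tsum (u := fun i : ℕ => r⁻¹ ^ (i + 1)) (fun i => ?_)
    (summable_geometric_succ hr) (fun i q hq => ?_)
  · refine ContinuousOn.div continuousOn_const (by fun_prop) (fun q hq => ?_)
    have : (0 : ℝ) < q := by linarith [hq.1]
    positivity
  · rw [Real.norm_of_nonneg (digit_term_nonneg (by linarith [hq.1]) d i)]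
    exact digit_term_le hr hq.1 d i

/-- Remainders of the greedy algorithm in base `q` started at `x`. -/
noncomputable def greedyRem (q x : ℝ) : ℕ → ℝ
  | 0 => x
  | n + 1 => if 1 ≤ q * greedyRem q x n then q * greedyRem q x n - 1 else q * greedyRem q x n

theorem exists_val_eq {q x : ℝ} (hq : 1 < q) (hq2 : q ≤ 2) (hx : 0 ≤ x) (hx' : x ≤ 1 / (q - 1)) :
    ∃ d : ℕ → Fin 2, val q d = x := by
  have hq0 : (0 : ℝ) < q := by linarith
  have hq1 : (0 : ℝ) < q - 1 := by linarith
  -- This is where q ≤ 2 enters: a remainder kept below 1 by a digit 0 is still at most 1 / (q - 1).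
  have hone : 1 ≤ 1 / (q - 1) := by rw [le_div_iff₀ hq1]; linarith
  have hb : ∀ n, 0 ≤ greedyRem q x n ∧ greedyRem q x n ≤ 1 / (q - 1) := by
    intro n
    induction n with
    | zero => exact ⟨hx, hx'⟩
    | succ n ih =>
      rw [greedyRem]
      split_ifs with h
      · refine ⟨by linarith, ?_⟩
        have h1 : q * greedyRem q x n ≤ q * (1 / (q - 1)) := by gcongr; exact ih.2
        have h2 : q * (1 / (q - 1)) - 1 = 1 / (q - 1) := by field_simp; ring
        linarith
      · exact ⟨mul_nonneg hq0.le ih.1, by linarith⟩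
  classical
  let d : ℕ → Fin 2 := fun n => if 1 ≤ q * greedyRem q x n then 1 else 0
  have hd : ∀ n, x = partialVal q d n + greedyRem q x n / q ^ n := by
    intro n
    induction n with
    | zero => simp [partialVal, greedyRem]
    | succ n ih =>
      rw [partialVal, Finset.sum_range_succ, ← partialVal, greedyRem]
      nth_rewrite 1 [ih]
      by_cases h : 1 ≤ q * greedyRem q x n
      · simp only [d, h, if_true, Fin.val_one, Nat.cast_one]
        field_simp
        ring
      · simp only [d, h, if_false, Fin.val_zero, Nat.cast_zero]
        field_simp
        ring
  refine ⟨d, ?_⟩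
  have hlim : Filter.Tendsto (fun n => partialVal q d n) Filter.atTop (nhds x) := by
    have h0 : Filter.Tendsto (fun n => greedyRem q x n / q ^ n) Filter.atTop (nhds 0) := by
      refine squeeze_zero (g := fun n => (1 / (q - 1)) * q⁻¹ ^ n)
        (fun n => div_nonneg (hb n).1 (by positivity)) (fun n => ?_) ?_
      · rw [inv_pow, ← div_eq_mul_inv]
        gcongr
        exact (hb n).2
      · have := (tendsto_pow_atTop_nhds_zero_of_lt_one (r := q⁻¹) (by positivity)
          (inv_lt_one_of_one_lt₀ hq)).const_mul (1 / (q - 1))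
        simpa using this
    have : (fun n => partialVal q d n) = fun n => x - greedyRem q x n / q ^ n := by
      funext n
      linarith [hd n]
    rw [this]
    simpa using tendsto_const_nhds.sub h0
  exact tendsto_nhds_unique (summable_digits hq d).hasSum.tendsto_sum_nat hlim

/-! ### Unique expansions and admissible sequences. -/

/-- `d` is admissible in base `q`: after a digit `0` the remaining digits have value less
than `1`, and dually after a digit `1`. -/
def Admissible (q : ℝ) (d : ℕ → Fin 2) : Prop :=
  ∀ i, (d i = 0 → val q (drop (i + 1) d) < 1) ∧ (d i = 1 → val q (compl (drop (i + 1) d)) < 1)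

theorem Admissible.mono {p q : ℝ} (hp : 1 < p) (hpq : p ≤ q) {d : ℕ → Fin 2}
    (h : Admissible p d) : Admissible q d := fun i =>
  ⟨fun h0 => (val_anti hp hpq _).trans_lt ((h i).1 h0),
    fun h1 => (val_anti hp hpq _).trans_lt ((h i).2 h1)⟩

theorem compl_compl (d : ℕ → Fin 2) : compl (compl d) = d := by
  funext i
  simp [compl]

theorem admissible_compl {q : ℝ} {d : ℕ → Fin 2} (h : Admissible q d) :
    Admissible q (compl d) := fun i => by
  refine ⟨fun h0 => (h i).2 ?_, fun h1 => ?_⟩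
  · rcases fin_two_cases (d i) with h2 | h2
    · simp [compl, h2] at h0
    · exact h2
  · rw [drop_compl, compl_compl]
    refine (h i).1 ?_
    rcases fin_two_cases (d i) with h2 | h2
    · exact h2
    · simp [compl, h2] at h1

theorem partialVal_congr {q : ℝ} {d e : ℕ → Fin 2} {n : ℕ} (h : ∀ i < n, d i = e i) :
    partialVal q d n = partialVal q e n :=
  Finset.sum_congr rfl fun i hi => by rw [h i (Finset.mem_range.1 hi)]

theorem partialVal_succ (q : ℝ) (d : ℕ → Fin 2) (n : ℕ) :
    partialVal q d (n + 1) = partialVal q d n + ((d n : ℕ) : ℝ) / q ^ (n + 1) :=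
  Finset.sum_range_succ _ _

/-- Otherwise the 0 at i could become a 1, followed by an expansion of the tail's value minus 1: a
second expansion. -/
theorem val_drop_lt_one_of_unique {q : ℝ} (hq : 1 < q) (hq2 : q ≤ 2) {d : ℕ → Fin 2}
    (h : ∀ e, val q e = val q d → e = d) {i : ℕ} (hi : d i = 0) : val q (drop (i + 1) d) < 1 := by
  have hq0 : (0 : ℝ) < q := by linarith
  by_contra! hge
  obtain ⟨t, ht⟩ := exists_val_eq (x := val q (drop (i + 1) d) - 1) hq hq2 (by linarith)
    (by linarith [val_le hq (drop (i + 1) d)])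
  let e : ℕ → Fin 2 := fun l => if l < i then d l else if l = i then 1 else t (l - (i + 1))
  have hdrop : drop (i + 1) e = t := by
    funext l
    simp only [drop, e]
    rw [if_neg (by omega), if_neg (by omega)]
    congr 1
    omega
  have he : e i = 1 := by simp [e]
  have hpre : partialVal q e i = partialVal q d i :=
    partialVal_congr fun l hl => by simp [e, hl]
  have hv : val q e = val q d := by
    rw [val_eq_partialVal_add hq e (i + 1), val_eq_partialVal_add hq d (i + 1), partialVal_succ,
      partialVal_succ, hpre, hdrop, ht, he, hi]
    simp
    ring
  have := h e hv
  rw [this, hi] at he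
  exact absurd he (by decide)

theorem admissible_of_unique {q : ℝ} (hq : 1 < q) (hq2 : q ≤ 2) {d : ℕ → Fin 2}
    (h : ∀ e, val q e = val q d → e = d) : Admissible q d := fun i => by
  refine ⟨val_drop_lt_one_of_unique hq hq2 h, fun h1 => ?_⟩
  rw [← drop_compl]
  refine val_drop_lt_one_of_unique hq hq2 (fun e he => ?_) (by simp [compl, h1])
  rw [← h (compl e), compl_compl]
  rw [val_compl hq, he, val_compl hq]
  ring

/-- The digit 1 of e at i outweighs the whole tail of d after its 0. Nothing is asked of e, so
uniqueness holds among all expansions. -/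
theorem Admissible.lt_of_first_diff {q : ℝ} (hq : 1 < q) {d e : ℕ → Fin 2} (h : Admissible q d)
    {i : ℕ} (hlt : ∀ l < i, e l = d l) (hd : d i = 0) (he : e i = 1) : val q d < val q e := by
  have hq0 : (0 : ℝ) < q := by linarith
  rw [val_eq_partialVal_add hq e (i + 1), val_eq_partialVal_add hq d (i + 1), partialVal_succ,
      partialVal_succ, partialVal_congr hlt, hd, he]
  have h1 := (h i).1 hd
  have h2 := val_nonneg hq (drop (i + 1) e)
  have h3 : val q (drop (i + 1) d) / q ^ (i + 1) < 1 / q ^ (i + 1) := by gcongr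
  have h4 : 0 ≤ val q (drop (i + 1) e) / q ^ (i + 1) := by positivity
  simp
  simp at h3
  linarith

theorem exists_first_diff {d e : ℕ → Fin 2} (h : e ≠ d) :
    ∃ i, (∀ l < i, e l = d l) ∧ e i ≠ d i := by
  classical
  have h' : ∃ i, e i ≠ d i := by
    by_contra! hc
    exact h (funext hc)
  exact ⟨Nat.find h', fun l hl => by simpa using Nat.find_min h' hl, Nat.find_spec h'⟩

theorem Admissible.unique {q : ℝ} (hq : 1 < q) {d e : ℕ → Fin 2} (h : Admissible q d)
    (hv : val q e = val q d) : e = d := by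
  by_contra hne
  obtain ⟨i, hlt, hi⟩ := exists_first_diff hne
  rcases fin_two_cases (d i) with hd | hd
  · have he : e i = 1 := by omega
    exact (h.lt_of_first_diff hq hlt hd he).ne hv.symm
  · have he : e i = 0 := by omega
    have := (admissible_compl h).lt_of_first_diff hq (e := compl e) (i := i)
      (fun l hl => by simp [compl, hlt l hl]) (by simp [compl, hd])
      (by simp [compl, he])
    rw [val_compl hq, val_compl hq, hv] at this
    exact lt_irrefl _ this

theorem mem_univoqueBases_iff {q x : ℝ} :
    q ∈ univoqueBases x ↔ 1 < q ∧ q ≤ 2 ∧ ∃ d, val q d = x ∧ Admissible q d := by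
  refine and_congr_right fun hq => and_congr_right fun hq2 => ?_
  constructor
  · rintro ⟨d, hd, hu⟩
    rw [isExpansion_iff hq] at hd
    refine ⟨d, hd, admissible_of_unique hq hq2 fun e he => hu e ?_⟩
    simp only [isExpansion_iff hq]
    rw [he, hd]
  · rintro ⟨d, hd, ha⟩
    refine ⟨d, (isExpansion_iff hq).2 hd, fun e he => ?_⟩
    simp only [isExpansion_iff hq] at he
    exact ha.unique hq (he.trans hd.symm)

/-! ### The Thue–Morse sequence and the values of its blocks. -/

theorem thueMorse_zero : thueMorse 0 = 0 := by simp [thueMorse]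

theorem thueMorse_one : thueMorse 1 = 1 := by simp [thueMorse]

theorem thueMorse_two_mul (i : ℕ) : thueMorse (2 * i) = thueMorse i := by
  rcases Nat.eq_zero_or_pos i with rfl | hi
  · rfl
  · have h : (Nat.digits 2 (2 * i)).count 1 = (Nat.digits 2 i).count 1 := by
      rw [Nat.digits_def' (by norm_num) (by omega)]
      simp
    apply Fin.ext
    simp only [thueMorse, h]

theorem thueMorse_two_mul_add_one (i : ℕ) : thueMorse (2 * i + 1) = 1 - thueMorse i := by
  have h : (Nat.digits 2 (2 * i + 1)).count 1 = (Nat.digits 2 i).count 1 + 1 := by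
    rw [Nat.digits_def' (by norm_num) (by omega)]
    have h1 : (2 * i + 1) % 2 = 1 := by omega
    have h2 : (2 * i + 1) / 2 = i := by omega
    rw [h1, h2, List.count_cons_self]
  apply Fin.ext
  simp only [thueMorse, h, Fin.sub_def, Fin.val_one]
  omega

theorem thueMorse_two_pow_add (j : ℕ) : ∀ i < 2 ^ j, thueMorse (2 ^ j + i) = 1 - thueMorse i := by
  induction j with
  | zero =>
    intro i hi
    obtain rfl : i = 0 := by simpa using hi
    simp [thueMorse_one, thueMorse_zero]
  | succ j ih =>
    intro i hi
    rcases Nat.even_or_odd' i with ⟨c, rfl | rfl⟩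
    · have hc : c < 2 ^ j := by rw [pow_succ] at hi; omega
      rw [show 2 ^ (j + 1) + 2 * c = 2 * (2 ^ j + c) by ring, thueMorse_two_mul,
        thueMorse_two_mul, ih c hc]
    · have hc : c < 2 ^ j := by rw [pow_succ] at hi; omega
      rw [show 2 ^ (j + 1) + (2 * c + 1) = 2 * (2 ^ j + c) + 1 by ring,
        thueMorse_two_mul_add_one, thueMorse_two_mul_add_one, ih c hc]

theorem thueMorse_two_pow (j : ℕ) : thueMorse (2 ^ j) = 1 := by
  simpa [thueMorse_zero] using thueMorse_two_pow_add j 0 (by positivity)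

theorem partialVal_compl {q : ℝ} (hq : 1 < q) (d : ℕ → Fin 2) (n : ℕ) :
    partialVal q (compl d) n = (1 - 1 / q ^ n) / (q - 1) - partialVal q d n := by
  have hq0 : (0 : ℝ) < q := by linarith
  have hq1 : (0 : ℝ) < q - 1 := by linarith
  induction n with
  | zero => simp [partialVal]
  | succ n ih =>
    rw [partialVal_succ, partialVal_succ, ih, compl, cast_one_sub]
    field_simp
    ring

theorem partialVal_add {q : ℝ} (hq : 1 < q) (d : ℕ → Fin 2) (m n : ℕ) :
    partialVal q d (m + n) = partialVal q d m + partialVal q (drop m d) n / q ^ m := by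
  have hq0 : (0 : ℝ) < q := by linarith
  rw [partialVal, Finset.sum_range_add, partialVal, partialVal, Finset.sum_div]
  congr 1
  refine Finset.sum_congr rfl fun i _ => ?_
  rw [drop, div_div, ← pow_add]
  congr 2
  ring

theorem partialVal_nonneg {q : ℝ} (hq : 1 < q) (d : ℕ → Fin 2) (n : ℕ) : 0 ≤ partialVal q d n :=
  Finset.sum_nonneg fun i _ => digit_term_nonneg hq d i

theorem inv_le_partialVal {q : ℝ} (hq : 1 < q) {d : ℕ → Fin 2} (h0 : d 0 = 1) {n : ℕ}
    (hn : 0 < n) : 1 / q ≤ partialVal q d n := by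
  have := Finset.single_le_sum (f := fun i => ((d i : ℕ) : ℝ) / q ^ (i + 1))
    (fun i _ => digit_term_nonneg hq d i) (Finset.mem_range.2 hn)
  simpa [h0, partialVal] using this

/-- The value of the Thue-Morse digits `τ_a, …, τ_{a+n-1}` followed by a sequence of value `t`. -/
noncomputable def blockVal (q : ℝ) (a n : ℕ) (t : ℝ) : ℝ :=
  partialVal q (drop a thueMorse) n + t / q ^ n

theorem blockVal_zero (q : ℝ) (a : ℕ) (t : ℝ) : blockVal q a 0 t = t := by
  simp [blockVal, partialVal]

theorem val_drop_thueMorse {q : ℝ} (hq : 1 < q) (a n : ℕ) :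
    val q (drop a thueMorse) = blockVal q a n (val q (drop (a + n) thueMorse)) := by
  rw [val_eq_partialVal_add hq _ n, blockVal, drop_drop]

theorem blockVal_add {q : ℝ} (hq : 1 < q) (a m n : ℕ) (t : ℝ) :
    blockVal q a (m + n) t = blockVal q a m (blockVal q (a + m) n t) := by
  have hq0 : (0 : ℝ) < q := by linarith
  simp only [blockVal]
  rw [partialVal_add hq, drop_drop, pow_add]
  field_simp
  ring

theorem blockVal_mono {q : ℝ} (hq : 1 < q) (a n : ℕ) {s t : ℝ} (h : s ≤ t) :
    blockVal q a n s ≤ blockVal q a n t := by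
  have hq0 : (0 : ℝ) < q := by linarith
  simp only [blockVal]
  gcongr

theorem blockVal_strictMono {q : ℝ} (hq : 1 < q) (a n : ℕ) {s t : ℝ} (h : s < t) :
    blockVal q a n s < blockVal q a n t := by
  have hq0 : (0 : ℝ) < q := by linarith
  simp only [blockVal]
  gcongr

/-- Shifting by 2^j complements the block, so upper and lower bounds are exchanged. -/
theorem blockVal_two_pow_add {q : ℝ} (hq : 1 < q) {j a n : ℕ} (h : a + n ≤ 2 ^ j) (t : ℝ) :
    blockVal q (2 ^ j + a) n t = 1 / (q - 1) - blockVal q a n (1 / (q - 1) - t) := by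
  have hq0 : (0 : ℝ) < q := by linarith
  have hq1 : (0 : ℝ) < q - 1 := by linarith
  have : partialVal q (drop (2 ^ j + a) thueMorse) n
      = partialVal q (compl (drop a thueMorse)) n := by
    refine partialVal_congr fun i hi => ?_
    simp only [drop, compl]
    rw [add_assoc, thueMorse_two_pow_add j _ (by omega)]
  rw [blockVal, this, partialVal_compl hq, blockVal]
  field_simp
  ring

/-- The value of the first `2 ^ j` Thue-Morse digits satisfies a recursion in `j`. -/
theorem partialVal_thueMorse_two_pow_succ {q : ℝ} (hq : 1 < q) (j : ℕ) :
    partialVal q thueMorse (2 ^ (j + 1)) =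
      (1 - 1 / q ^ 2 ^ j) * (partialVal q thueMorse (2 ^ j) + 1 / q ^ 2 ^ j / (q - 1)) := by
  have hq0 : (0 : ℝ) < q := by linarith
  have hq1 : (0 : ℝ) < q - 1 := by linarith
  have h := blockVal_two_pow_add hq (j := j) (a := 0) (n := 2 ^ j) (by omega) 0
  simp only [blockVal, add_zero, zero_div] at h
  rw [pow_succ, mul_two, partialVal_add hq, h, show drop 0 thueMorse = thueMorse from by
    funext i; simp [drop]]
  field_simp
  ring

/-! ### Numerical bounds for the Komornik–Loreti constant. -/

theorem one_lt_qKL : 1 < qKL := qKL_spec.1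

theorem qKL_lt_two : qKL < 2 := qKL_spec.2.1

theorem val_qKL_drop_one : val qKL (drop 1 thueMorse) = 1 := by
  have := (isExpansion_iff one_lt_qKL).1 qKL_spec.2.2
  rw [← this]
  congr 1
  funext i
  rw [drop, add_comm]

theorem val_qKL_thueMorse : val qKL thueMorse = 1 / qKL := by
  rw [val_eq_head_add one_lt_qKL, val_qKL_drop_one, thueMorse_zero]
  simp

theorem qKL_ge : 8 / 5 ≤ qKL := by
  have h := val_eq_partialVal_add one_lt_qKL (drop 1 thueMorse) 2
  rw [val_qKL_drop_one] at h
  have h0 := val_nonneg one_lt_qKL (drop 2 (drop 1 thueMorse))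
  have hp := one_lt_qKL
  have hp0 : 0 < qKL := by linarith
  have h2 : thueMorse 2 = 1 := thueMorse_two_pow 1
  have h1 : 0 ≤ val qKL (drop 2 (drop 1 thueMorse)) / qKL ^ 2 := by positivity
  simp only [partialVal, drop, Finset.sum_range_succ, Finset.sum_range_zero, add_zero,
    thueMorse_one, h2, Fin.val_one, Nat.cast_one, one_add_one_eq_two, zero_add, pow_one] at h
  have h3 : 1 / qKL + 1 / qKL ^ 2 ≤ 1 := by
    linarith [h.ge]
  have h4 : qKL + 1 ≤ qKL ^ 2 := by
    have := mul_le_mul_of_nonneg_right h3 (sq_nonneg qKL)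
    have e : (1 / qKL + 1 / qKL ^ 2) * qKL ^ 2 = qKL + 1 := by field_simp
    linarith
  nlinarith

/-- The bound 11/6 is the threshold both for 1/p < 5 (`tailLim` - 1/p) and for 1/(p - 1) - 1 > 1/5,
and is used in both forms. -/
theorem qKL_lt : qKL < 11 / 6 := by
  by_contra! hge
  have h := val_anti (q := 11 / 6) (by norm_num) hge (drop 1 thueMorse)
  rw [val_qKL_drop_one, val_eq_partialVal_add (by norm_num) _ 8] at h
  have h1 := val_le (q := 11 / 6) (by norm_num) (drop 8 (drop 1 thueMorse))
  have h2 : val (11 / 6) (drop 8 (drop 1 thueMorse)) / (11 / 6) ^ 8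
      ≤ 1 / (11 / 6 - 1) / (11 / 6 : ℝ) ^ 8 := by gcongr
  have h3 : partialVal (11 / 6) (drop 1 thueMorse) 8 ≤ 24 / 25 := by
    simp [partialVal, drop, Finset.sum_range_succ, thueMorse]
    norm_num
  have h4 : 1 / (11 / 6 - 1) / (11 / 6 : ℝ) ^ 8 < 1 / 25 := by norm_num
  linarith

/-! ### Thue–Morse tails in base `qKL`: monotonicity and bounds. -/

/-- The value in base `q_KL` of the Thue-Morse sequence from index `2 ^ j` on. -/
noncomputable def tailVal (j : ℕ) : ℝ := val qKL (drop (2 ^ j) thueMorse)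

/-- The limit of `tailVal`: the value in base `q_KL` of the complement of the Thue-Morse
sequence. -/
noncomputable def tailLim : ℝ := val qKL (compl thueMorse)

theorem tailLim_eq : tailLim = 1 / (qKL - 1) - 1 / qKL := by
  rw [tailLim, val_compl one_lt_qKL, val_qKL_thueMorse]

theorem tailVal_zero : tailVal 0 = 1 := val_qKL_drop_one

theorem inv_lt_tailVal (j : ℕ) : 1 / qKL < tailVal j := by
  have hp := one_lt_qKL
  have hp0 : 0 < qKL := by linarith
  have h := val_eq_partialVal_add one_lt_qKL (drop (2 ^ j) thueMorse) (2 ^ j + 1)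
  have hd : drop (2 ^ j) thueMorse (2 ^ j) = 1 := by
    rw [drop, ← two_mul, ← pow_succ', thueMorse_two_pow]
  have h1 := val_nonneg one_lt_qKL (drop (2 ^ j + 1) (drop (2 ^ j) thueMorse))
  have hpos : 0 < 2 ^ j := by positivity
  have h2 : 1 / qKL ≤ partialVal qKL (drop (2 ^ j) thueMorse) (2 ^ j) :=
    inv_le_partialVal one_lt_qKL (thueMorse_two_pow j) hpos
  rw [tailVal, h, partialVal_succ, hd]
  have h3 : 0 < 1 / qKL ^ (2 ^ j + 1) := by positivity
  have h4 : 0 ≤ val qKL (drop (2 ^ j + 1) (drop (2 ^ j) thueMorse)) / qKL ^ (2 ^ j + 1) := by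
    positivity
  simp only [Fin.val_one, Nat.cast_one]
  linarith

theorem tailVal_le (j : ℕ) : tailVal j ≤ 1 / (qKL - 1) := val_le one_lt_qKL _

/-- The value 1/p of τ is split at 2^j and at 2^(j+1), and the initial parts are eliminated with
`partialVal_thueMorse_two_pow_succ`. -/
theorem tailVal_recursion (j : ℕ) :
    (1 - 1 / qKL ^ 2 ^ j) * (tailVal j - tailLim) =
      1 / qKL ^ 2 ^ j * (tailVal (j + 1) - 1 / qKL) := by
  have hp := one_lt_qKL
  have hp0 : 0 < qKL := by linarith
  have hp1 : 0 < qKL - 1 := by linarith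
  have h1 := val_eq_partialVal_add one_lt_qKL thueMorse (2 ^ j)
  have h2 := val_eq_partialVal_add one_lt_qKL thueMorse (2 ^ (j + 1))
  rw [partialVal_thueMorse_two_pow_succ one_lt_qKL, pow_succ 2 j, pow_mul] at h2
  rw [val_qKL_thueMorse] at h1 h2
  have hQ : 0 < qKL ^ 2 ^ j := by positivity
  rw [tailLim_eq, tailVal, tailVal, pow_succ 2 j]
  generalize val qKL (drop (2 ^ j) thueMorse) = x at *
  generalize val qKL (drop (2 ^ j * 2) thueMorse) = y at *
  generalize qKL ^ 2 ^ j = R at *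
  have h3 : partialVal qKL thueMorse (2 ^ j) = 1 / qKL - x / R := by linarith
  rw [h3] at h2
  generalize qKL = p at *
  field_simp at h2 ⊢
  linear_combination h2

theorem tailLim_lt_tailVal (j : ℕ) : tailLim < tailVal j := by
  have hp := one_lt_qKL
  have h := tailVal_recursion j
  have h1 := inv_lt_tailVal (j + 1)
  have hQ1 : 1 < qKL ^ 2 ^ j := one_lt_pow₀ hp (by positivity)
  have hQ : 1 / qKL ^ 2 ^ j < 1 := by rw [div_lt_one (by positivity)]; exact hQ1
  have h2 : 0 < 1 / qKL ^ 2 ^ j * (tailVal (j + 1) - 1 / qKL) :=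
    mul_pos (by positivity) (by linarith)
  rw [← h] at h2
  linarith [(mul_pos_iff_of_pos_left (by linarith : 0 < 1 - 1 / qKL ^ 2 ^ j)).1 h2]

theorem inv_qKL_lt_tailLim : 1 / qKL < tailLim := by
  have hp := one_lt_qKL
  have hp0 : 0 < qKL := by linarith
  have hp1 : 0 < qKL - 1 := by linarith
  have h2 := qKL_lt_two
  rw [tailLim_eq, lt_sub_iff_add_lt, ← add_div, lt_div_iff₀ hp1]
  rw [div_mul_eq_mul_div, div_lt_iff₀ hp0]
  linarith

theorem tailVal_succ_lt (j : ℕ) : tailVal (j + 1) < tailVal j := by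
  have hp := one_lt_qKL
  have hp0 : 0 < qKL := by linarith
  have hp1 : 0 < qKL - 1 := by linarith
  have h0 := tailVal_recursion j
  have h1 := tailVal_recursion (j + 1)
  have hQ1 : 1 < qKL ^ 2 ^ j := one_lt_pow₀ hp (by positivity)
  have hQ : 1 / qKL ^ 2 ^ j < 1 := by rw [div_lt_one (by positivity)]; exact hQ1
  have hQ0 : 0 < 1 / qKL ^ 2 ^ j := by positivity
  have hsq : 1 / qKL ^ 2 ^ (j + 1) = (1 / qKL ^ 2 ^ j) ^ 2 := by
    rw [pow_succ 2 j, pow_mul]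
    field_simp
  rw [hsq] at h1
  have he2 := tailVal_le (j + 2)
  have he1 := tailLim_lt_tailVal (j + 1)
  have hc := inv_qKL_lt_tailLim
  have hc5 : 1 / qKL ≤ 5 * (tailLim - 1 / qKL) := by
    have h3 := qKL_lt
    rw [tailLim_eq]
    have : 5 * (1 / (qKL - 1) - 1 / qKL - 1 / qKL) - 1 / qKL
        = (11 - 6 * qKL) / (qKL * (qKL - 1)) := by field_simp; ring
    have : 0 ≤ (11 - 6 * qKL) / (qKL * (qKL - 1)) :=
      div_nonneg (by linarith) (by positivity)
    linarith
  have hlim := tailLim_eq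
  have he2' : tailVal (j + 2) - 1 / qKL ≤ 6 * (tailLim - 1 / qKL) := by linarith
  have hj : j + 1 + 1 = j + 2 := rfl
  rw [hj] at h1
  set Q := 1 / qKL ^ 2 ^ j
  set c := tailLim - 1 / qKL
  set e1 := tailVal (j + 1) - tailLim
  -- The recursion at j with the limit subtracted. The recursion at j + 1 makes e1 of order Q², so
  -- the term Q * c should win.
  have key : (1 - Q) * (tailVal j - tailVal (j + 1)) = Q * c - (1 - 2 * Q) * e1 := by
    simp only [e1, c]
    linear_combination h0
  have hcpos : 0 < c := by simp only [c]; linarith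
  have he1pos : 0 < e1 := by simp only [e1]; linarith
  have hpos : 0 < Q * c - (1 - 2 * Q) * e1 := by
    rcases le_or_gt 1 (2 * Q) with h2 | h2
    · have : 0 < Q * c := mul_pos hQ0 hcpos
      nlinarith
    · have h4 : (1 - Q ^ 2) * e1 ≤ Q ^ 2 * (6 * c) := by
        rw [h1]
        gcongr
      have h5 : 0 < 1 - Q ^ 2 := by nlinarith
      have h6 : 0 < (1 - Q ^ 2) * (Q * c - (1 - 2 * Q) * e1) := by
        have h7 : (1 - 2 * Q) * ((1 - Q ^ 2) * e1) ≤ (1 - 2 * Q) * (Q ^ 2 * (6 * c)) := by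
          gcongr
        -- After inserting e1 ≤ 6 Q² c / (1 - Q²), what remains is 1 - 6Q + 11Q² > 0, which has
        -- negative discriminant.
        have h8 : 0 < Q * c * ((1 - Q ^ 2) - (1 - 2 * Q) * Q * 6) :=
          mul_pos (mul_pos hQ0 hcpos) (by nlinarith [sq_nonneg (Q - 1 / 4)])
        nlinarith
      exact (mul_pos_iff_of_pos_left h5).1 h6
  rw [← key] at hpos
  linarith [(mul_pos_iff_of_pos_left (by linarith : 0 < 1 - Q)).1 hpos]

theorem tailVal_strictAnti : StrictAnti tailVal := strictAnti_nat_of_succ_lt tailVal_succ_lt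

theorem tailVal_sub_tailLim_le {j : ℕ} (hj : 1 ≤ j) :
    tailVal j - tailLim ≤ 2 / qKL ^ 2 ^ j := by
  have hp := qKL_ge
  have hp' := one_lt_qKL
  have hp0 : 0 < qKL := by linarith
  have h0 := tailVal_recursion j
  have hQ1 : (64 : ℝ) / 25 ≤ qKL ^ 2 ^ j := by
    calc (64 : ℝ) / 25 = (8 / 5) ^ 2 := by norm_num
      _ ≤ qKL ^ 2 := by gcongr
      _ ≤ qKL ^ 2 ^ j := pow_le_pow_right₀ hp'.le (by
        calc 2 = 2 ^ 1 := rfl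
          _ ≤ 2 ^ j := Nat.pow_le_pow_right (by norm_num) hj)
  have hQ : 1 / qKL ^ 2 ^ j ≤ 25 / 64 := by
    rw [div_le_iff₀ (by positivity)]
    linarith
  -- The left side is below 1; 78/64 is twice the lower bound 39/64 for 1 - Q, which yields the
  -- constant 2.
  have h1 : tailVal (j + 1) - 1 / qKL ≤ 78 / 64 := by
    have h3 : tailVal (j + 1) ≤ tailVal 0 := tailVal_strictAnti.antitone (by omega)
    rw [tailVal_zero] at h3
    have : 0 < 1 / qKL := by positivity
    linarith
  have hQ0 : 0 < 1 / qKL ^ 2 ^ j := by positivity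
  have h2 := tailLim_lt_tailVal j
  rw [show 2 / qKL ^ 2 ^ j = 2 * (1 / qKL ^ 2 ^ j) by ring]
  set Q := 1 / qKL ^ 2 ^ j
  have h3 : Q * (tailVal (j + 1) - 1 / qKL) ≤ Q * (78 / 64) := by gcongr
  nlinarith

/-- Every tail of the Thue-Morse sequence after index `1` has value less than `1` in base
`q_KL`, and all its digit blocks ending at a power of `2`, followed by the smallest possible
continuation, have value greater than `1 / (q_KL - 1) - 1`. -/
theorem tail_bounds (j : ℕ) :
    (∀ a, 2 ≤ a → a ≤ 2 ^ j → val qKL (drop a thueMorse) < 1) ∧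
    (∀ a n, 1 ≤ a → a + n = 2 ^ j →
      1 / (qKL - 1) - 1 < blockVal qKL a n (1 / (qKL - 1) - tailVal (j + 1))) := by
  have hp := one_lt_qKL
  have hp0 : 0 < qKL := by linarith
  induction j with
  | zero =>
    refine ⟨fun a h1 h2 => by simp at h2; omega, fun a n h1 h2 => ?_⟩
    obtain ⟨rfl, rfl⟩ : a = 1 ∧ n = 0 := by simp at h2; omega
    rw [blockVal_zero]
    have := tailVal_strictAnti (show 0 < 0 + 1 by norm_num)
    rw [tailVal_zero] at this
    linarith
  | succ j ih =>
    obtain ⟨hub, hlb⟩ := ih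
    have hle : ∀ a, 1 ≤ a → a ≤ 2 ^ j → val qKL (drop a thueMorse) ≤ 1 := by
      intro a h1 h2
      rcases eq_or_lt_of_le h1 with rfl | h3
      · exact val_qKL_drop_one.le
      · exact (hub a h3 h2).le
    have hpow : 2 ^ (j + 1) = 2 ^ j + 2 ^ j := by ring
    constructor
    · intro a h2 ha
      rcases le_or_gt a (2 ^ j) with h | h
      · exact hub a h2 h
      -- Reflection turns the upper bound at 2^j + b into the lower bound at b; the continuation in
      -- `hlb` is exactly the complemented tail that appears.
      · obtain ⟨b, rfl⟩ := Nat.exists_eq_add_of_le h.le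
        obtain ⟨n, hn⟩ := Nat.exists_eq_add_of_le (show b ≤ 2 ^ j by omega)
        have := hlb b n (by omega) hn.symm
        rw [val_drop_thueMorse hp (2 ^ j + b) n, blockVal_two_pow_add hp hn.ge,
          show 2 ^ j + b + n = 2 ^ (j + 1) by omega]
        rw [tailVal] at this
        linarith
    · intro a n h1 ha
      rcases le_or_gt a (2 ^ j) with h | h
      · obtain ⟨m, hm⟩ := Nat.exists_eq_add_of_le h
        have hn : n = m + 2 ^ j := by omega
        refine (hlb a m h1 hm.symm).trans ?_
        rw [hn, blockVal_add hp]
        refine blockVal_strictMono hp _ _ ?_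
        rw [← hm]
        -- The added block starts with the digit 1, hence is worth at least 1/p, more than the
        -- continuation allowed by the induction hypothesis.
        have h3 : 1 / (qKL - 1) - tailVal (j + 1) < 1 / qKL := by
          have := tailLim_lt_tailVal (j + 1)
          rw [tailLim_eq] at this
          linarith
        refine h3.trans_le ?_
        rw [blockVal]
        have h4 : 0 ≤ (1 / (qKL - 1) - tailVal (j + 1 + 1)) / qKL ^ 2 ^ j :=
          div_nonneg (by linarith [tailVal_le (j + 1 + 1)]) (by positivity)
        have h5 : 1 / qKL ≤ partialVal qKL (drop (2 ^ j) thueMorse) (2 ^ j) :=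
          inv_le_partialVal hp (thueMorse_two_pow j) (by positivity)
        linarith
      · obtain ⟨b, rfl⟩ := Nat.exists_eq_add_of_le h.le
        have hn : b + n = 2 ^ j := by omega
        rw [blockVal_two_pow_add hp hn.le]
        -- Here the strict decrease of `tailVal` is essential: it puts the reflected block strictly
        -- below a true tail of τ.
        have h3 : blockVal qKL b n (tailVal (j + 1 + 1)) < val qKL (drop b thueMorse) := by
          rw [val_drop_thueMorse hp b n, hn]
          exact blockVal_strictMono hp _ _ (tailVal_strictAnti (by omega))
        have h4 := hle b (by omega) (by omega)
        rw [sub_sub_cancel]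
        linarith

theorem val_drop_thueMorse_lt_one {a : ℕ} (ha : 2 ≤ a) : val qKL (drop a thueMorse) < 1 :=
  (tail_bounds a).1 a ha Nat.lt_two_pow_self.le

theorem val_drop_thueMorse_le_one {a : ℕ} (ha : 1 ≤ a) : val qKL (drop a thueMorse) ≤ 1 := by
  rcases eq_or_lt_of_le ha with rfl | h
  · exact val_qKL_drop_one.le
  · exact (val_drop_thueMorse_lt_one h).le

theorem lt_blockVal {a n j : ℕ} (ha : 1 ≤ a) (h : a + n = 2 ^ j) {t : ℝ} (ht : 1 / qKL ≤ t) :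
    1 / (qKL - 1) - 1 < blockVal qKL a n t := by
  refine ((tail_bounds j).2 a n ha h).trans_le (blockVal_mono one_lt_qKL _ _ ?_)
  have := tailLim_lt_tailVal (j + 1)
  rw [tailLim_eq] at this
  linarith

theorem blockVal_lt_one {a n j : ℕ} (ha : 2 ≤ a) (h : a + n = 2 ^ j) {t : ℝ}
    (ht : t ≤ tailVal j) : blockVal qKL a n t < 1 := by
  refine (blockVal_mono one_lt_qKL _ _ ht).trans_lt ?_
  rw [tailVal, ← h, ← val_drop_thueMorse one_lt_qKL]
  exact val_drop_thueMorse_lt_one ha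

theorem lt_val_drop_thueMorse {a : ℕ} (ha : 1 ≤ a) :
    1 / (qKL - 1) - 1 < val qKL (drop a thueMorse) := by
  obtain ⟨n, hn⟩ := Nat.exists_eq_add_of_le (Nat.lt_two_pow_self (n := a)).le
  rw [val_drop_thueMorse one_lt_qKL a n, ← hn]
  exact lt_blockVal ha hn.symm (inv_lt_tailVal a).le

/-! ### Excluding bases below `qKL`. -/

/-- The complement of e after l reads τ_1…τ_r 1 and has value below 1. Since e has a 0 at l + 1 + r,
its later tail is below 1, so the complement of that tail exceeds 1/(q - 1) - 1. -/
theorem Admissible.partialVal_thueMorse_lt {q : ℝ} (hq : 1 < q) {e : ℕ → Fin 2}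
    (he : Admissible q e) {l r : ℕ} (h1 : e l = 1)
    (h : ∀ s < r, e (l + 1 + s) = 1 - thueMorse (1 + s)) (h0 : e (l + 1 + r) = 0) :
    partialVal q (drop 1 thueMorse) r + 1 / (q ^ (r + 1) * (q - 1)) < 1 := by
  have hq0 : (0 : ℝ) < q := by linarith
  have hq1 : (0 : ℝ) < q - 1 := by linarith
  have hl := (he l).2 h1
  have hr := (he (l + 1 + r)).1 h0
  rw [val_eq_partialVal_add hq _ (r + 1), partialVal_succ, drop_compl, drop_drop,
    val_compl hq] at hl
  have hc : partialVal q (compl (drop (l + 1) e)) r = partialVal q (drop 1 thueMorse) r :=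
    partialVal_congr fun s hs => by
      simp only [compl, drop]
      rw [h s hs]
      simp
  have hd : compl (drop (l + 1) e) r = 1 := by
    simp only [compl, drop]
    rw [h0]
    rfl
  rw [hc, hd, Fin.val_one, Nat.cast_one, show l + 1 + (r + 1) = l + 1 + r + 1 by ring] at hl
  have h2 : (1 / (q - 1) - 1) / q ^ (r + 1) ≤
      (1 / (q - 1) - val q (drop (l + 1 + r + 1) e)) / q ^ (r + 1) := by gcongr
  have h3 : 1 / (q ^ (r + 1) * (q - 1)) = 1 / q ^ (r + 1) + (1 / (q - 1) - 1) / q ^ (r + 1) := by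
    field_simp
    ring
  linarith

theorem one_le_partialVal_thueMorse {q : ℝ} (hq : 1 < q) (hqp : q < qKL) {r : ℕ}
    (h : thueMorse (1 + r) = 0) :
    1 ≤ partialVal q (drop 1 thueMorse) r + 1 / (q ^ (r + 1) * (q - 1)) := by
  have hq0 : (0 : ℝ) < q := by linarith
  have hq1 : (0 : ℝ) < q - 1 := by linarith
  have hp := one_lt_qKL
  have hp2 := qKL_lt_two
  have h1 := val_eq_partialVal_add hp (drop 1 thueMorse) (r + 1)
  have hd : drop 1 thueMorse r = 0 := h
  rw [val_qKL_drop_one, partialVal_succ, hd, drop_drop] at h1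
  have h2 := val_drop_thueMorse_le_one (a := 1 + (r + 1)) (by omega)
  have h3 := partialVal_anti hq hqp.le (drop 1 thueMorse) r
  have h4 : val qKL (drop (1 + (r + 1)) thueMorse) / qKL ^ (r + 1) ≤ 1 / q ^ (r + 1) := by
    gcongr
  have h5 : 1 / q ^ (r + 1) ≤ 1 / (q ^ (r + 1) * (q - 1)) := by
    gcongr
    nlinarith [pow_pos hq0 (r + 1)]
  simp only [Fin.val_zero, Nat.cast_zero, zero_div, add_zero] at h1
  linarith

/-- With R = q^(2^j), the doubling recursion bounds the longer sum by (1 - 1/R)(1 + 1/R) + 1/R² = 1.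
-/
theorem partialVal_two_pow_succ_lt_one {q : ℝ} (hq : 1 < q) {j r : ℕ} (hr : 1 + r = 2 ^ j)
    (h : partialVal q (drop 1 thueMorse) r + 1 / (q ^ (r + 1) * (q - 1)) < 1) :
    partialVal q (drop 1 thueMorse) (2 ^ (j + 1)) < 1 := by
  have hq0 : (0 : ℝ) < q := by linarith
  have hq1 : (0 : ℝ) < q - 1 := by linarith
  have h0 : partialVal q thueMorse 1 = 0 := by simp [partialVal, thueMorse_zero]
  have h1 := partialVal_add hq thueMorse 1 r
  have h2 := partialVal_add hq thueMorse 1 (2 ^ (j + 1))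
  rw [add_comm 1 (2 ^ (j + 1)), partialVal_succ, partialVal_thueMorse_two_pow_succ hq,
    thueMorse_two_pow, h0, zero_add, pow_one, Fin.val_one, Nat.cast_one] at h2
  rw [hr, h0, zero_add, pow_one] at h1
  rw [h1] at h2
  rw [add_comm r 1, hr] at h
  rw [pow_succ q, pow_succ 2 j, pow_mul] at h2
  rw [pow_succ 2 j]
  have hR : 1 < q ^ 2 ^ j := one_lt_pow₀ hq (by positivity)
  generalize partialVal q (drop 1 thueMorse) (2 ^ j * 2) = y at *
  generalize partialVal q (drop 1 thueMorse) r = x at *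
  generalize q ^ 2 ^ j = R at *
  have h3 : y = (1 - 1 / R) * (x + 1 / (R * (q - 1)) + 1 / R) + 1 / R ^ 2 := by
    field_simp at h2 ⊢
    linear_combination (-1) * h2
  have hR1 : 1 / R < 1 := by rw [div_lt_one (by linarith)]; exact hR
  rw [h3]
  have h4 : (1 - 1 / R) * (x + 1 / (R * (q - 1)) + 1 / R) < (1 - 1 / R) * (1 + 1 / R) := by
    gcongr
  have h5 : (1 - 1 / R) * (1 + 1 / R) + 1 / R ^ 2 = 1 := by
    field_simp
    ring
  linarith

/-- At the first 1, preceded by a 0 and followed by a tail of value V, admissibility says V < q - 1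
and 1/(q - 1) - V < 1. -/
theorem Admissible.one_lt_mul_of_head_zero {q : ℝ} (hq : 1 < q) {e : ℕ → Fin 2}
    (he : Admissible q e) (h0 : e 0 = 0) (hpos : 0 < val q e) : 1 < q * (q - 1) := by
  classical
  have hq0 : (0 : ℝ) < q := by linarith
  have hq1 : (0 : ℝ) < q - 1 := by linarith
  have hex : ∃ l, e l = 1 := by
    by_contra! hc
    have : val q e = 0 := by
      rw [val]
      convert tsum_zero with i
      have : e i = 0 := by
        have := hc i
        omega
      simp [this]
    linarith
  obtain ⟨l, hl, hmin⟩ : ∃ l, e l = 1 ∧ ∀ m < l, e m ≠ 1 :=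
    ⟨Nat.find hex, Nat.find_spec hex, fun m hm => Nat.find_min hex hm⟩
  obtain ⟨m, rfl⟩ : ∃ m, l = m + 1 := by
    rcases l with _ | m
    · rw [h0] at hl
      exact absurd hl (by decide)
    · exact ⟨m, rfl⟩
  have hm : e m = 0 := by
    have := hmin m (by omega)
    omega
  have h1 := (he m).1 hm
  have h2 := (he (m + 1)).2 hl
  rw [val_drop_eq hq, hl, div_lt_one hq0] at h1
  rw [val_compl hq] at h2
  simp only [Fin.val_one, Nat.cast_one] at h1
  have h3 : 1 / (q - 1) < q := by linarith
  rw [div_lt_iff₀ hq1] at h3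
  exact h3

/-- A criterion for the number with expansion `d` in base `q_KL` to have no unique expansion in
any base smaller than `q_KL`. -/
theorem qKL_le_of_mem_univoqueBases {d : ℕ → Fin 2} (h0 : d 0 = 1)
    (hlb : 1 / (qKL - 1) - 1 ≤ val qKL (drop 1 d))
    (hub : ∀ i, val qKL (drop (i + 1) d) ≤ 1)
    (H : ∀ i, 1 ≤ i → d i = 1 → ∃ l r, l + 1 + r = i ∧ d l = 1 ∧
      (∀ s < r, d (l + 1 + s) = 1 - thueMorse (1 + s)) ∧
      (thueMorse (1 + r) = 0 ∨ ∃ j, 1 + r = 2 ^ j ∧ ∀ q, 1 < q → q < qKL →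
        partialVal q (drop 1 thueMorse) (2 ^ (j + 1)) < 1 →
          partialVal q d (i + 1) ≤ val qKL d))
    {q : ℝ} (hmem : q ∈ univoqueBases (val qKL d)) : qKL ≤ q := by
  by_contra! hqp
  obtain ⟨hq, -, e, hv, he⟩ := mem_univoqueBases_iff.1 hmem
  have hq0 : (0 : ℝ) < q := by linarith
  have hp := one_lt_qKL
  have hp0 : 0 < qKL := by linarith
  have hp1 : 0 < qKL - 1 := by linarith
  have hne : e ≠ d := by
    rintro rfl
    have h1 := val_lt_of_base_lt hq hqp h0
    have h2 : 1 / qKL < 1 / q := by gcongr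
    linarith
  obtain ⟨i, hlt, hi⟩ := exists_first_diff hne
  have hve := val_eq_partialVal_add hq e (i + 1)
  have hvd := val_eq_partialVal_add hp d (i + 1)
  rw [partialVal_succ, partialVal_congr hlt] at hve
  -- If d has the 0, then e is already too large: smaller bases enlarge the common prefix, and the
  -- tail of d after i is worth at most one unit.
  rcases fin_two_cases (d i) with hd | hd
  · have hei : e i = 1 := by omega
    rw [partialVal_succ, hd] at hvd
    rw [hei] at hve
    have h1 := partialVal_anti hq hqp.le d i
    have h2 : 0 ≤ val q (drop (i + 1) e) / q ^ (i + 1) :=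
      div_nonneg (val_nonneg hq _) (by positivity)
    have h3 : val qKL (drop (i + 1) d) / qKL ^ (i + 1) ≤ 1 / qKL ^ (i + 1) := by
      gcongr
      exact hub i
    have h4 : 1 / qKL ^ (i + 1) < 1 / q ^ (i + 1) := by
      gcongr
    simp only [Fin.val_zero, Fin.val_one, Nat.cast_zero, Nat.cast_one, zero_div] at hve hvd
    linarith
  · have hei : e i = 0 := by omega
    have hlt1 : val q e < partialVal q d (i + 1) := by
      have h1 := (he i).1 hei
      have h2 : val q (drop (i + 1) e) / q ^ (i + 1) < 1 / q ^ (i + 1) := by gcongr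
      rw [hve, partialVal_succ, hei, hd]
      simp only [Fin.val_zero, Fin.val_one, Nat.cast_zero, Nat.cast_one, zero_div]
      linarith
    rcases Nat.eq_zero_or_pos i with rfl | hipos
    · have h1 : 1 / (qKL * (qKL - 1)) ≤ val qKL d := by
        rw [val_eq_head_add hp, h0, ← div_div, div_right_comm]
        gcongr
        simp only [Fin.val_one, Nat.cast_one]
        linarith
      have h2 : val q e < 1 / q := by
        simpa [partialVal, h0] using hlt1
      have h3 : q < qKL * (qKL - 1) := by
        have : 1 / (qKL * (qKL - 1)) < 1 / q := by linarith
        rwa [one_div_lt_one_div (by positivity) hq0] at this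
      have h4 := he.one_lt_mul_of_head_zero hq hei (by
        rw [hv]
        exact lt_of_lt_of_le (by positivity) h1)
      -- From p < 11/6 follows q < p(p - 1) < 55/36, too small for q(q - 1) > 1.
      have h5 := qKL_lt
      nlinarith
    · obtain ⟨l, r, hlr, hl, hs, hr⟩ := H i hipos hd
      have hstar := he.partialVal_thueMorse_lt hq (l := l) (r := r)
        (by rw [hlt l (by omega), hl]) (fun s hsr => by rw [hlt _ (by omega), hs s hsr])
        (by rw [hlr, hei])
      rcases hr with hr | ⟨j, hj, hF⟩
      · linarith [one_le_partialVal_thueMorse hq hqp hr]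
      · have := hF q hq hqp (partialVal_two_pow_succ_lt_one hq hj hstar)
        linarith

/-! ### Variation of partial values with the base. -/

theorem inv_pow_sub_le {p q : ℝ} (hq : 1 < q) (hqp : q ≤ p) {s a b : ℕ} (hba : b ≤ a) :
    1 / q ^ s - 1 / p ^ s ≤ p ^ a * (1 / q ^ (s + b) - 1 / p ^ (s + b)) := by
  have hq0 : (0 : ℝ) < q := by linarith
  have hp0 : (0 : ℝ) < p := by linarith
  have hp1 : 1 ≤ p := by linarith
  have h1 : (0 : ℝ) ≤ 1 / q ^ (s + b) - 1 / p ^ (s + b) := by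
    rw [sub_nonneg]
    gcongr
  calc 1 / q ^ s - 1 / p ^ s ≤ p ^ b * (1 / q ^ (s + b) - 1 / p ^ (s + b)) := by
        rw [mul_sub]
        have h2 : p ^ b * (1 / p ^ (s + b)) = 1 / p ^ s := by
          rw [pow_add]
          field_simp
        have h3 : 1 / q ^ s = q ^ b * (1 / q ^ (s + b)) := by
          rw [pow_add]
          field_simp
        rw [h2, h3]
        gcongr
    _ ≤ _ := by gcongr

/-- Comparison of the variation in the base of two digit strings, where the first one arises
from the second by deleting digits. -/
theorem partialVal_sub_le {p q : ℝ} (hq : 1 < q) (hqp : q ≤ p) {c d : ℕ → Fin 2} {n G a : ℕ}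
    (φ : ℕ → ℕ) (hφ : StrictMono φ)
    (h : ∀ l < n, φ l < G ∧ φ l ≤ l + a ∧ d l = c (φ l)) :
    partialVal q d n - partialVal p d n ≤ p ^ a * (partialVal q c G - partialVal p c G) := by
  have hq0 : (0 : ℝ) < q := by linarith
  have hp0 : (0 : ℝ) < p := by linarith
  have key : ∀ s, (0 : ℝ) ≤ 1 / q ^ s - 1 / p ^ s := fun s => by
    rw [sub_nonneg]
    gcongr
  simp only [partialVal, ← Finset.sum_sub_distrib, Finset.mul_sum]
  calc _ ≤ ∑ l ∈ Finset.range n, p ^ a * (((c (φ l) : ℕ) : ℝ) / q ^ (φ l + 1)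
        - ((c (φ l) : ℕ) : ℝ) / p ^ (φ l + 1)) := by
        refine Finset.sum_le_sum fun l hl => ?_
        obtain ⟨-, h2, h3⟩ := h l (Finset.mem_range.1 hl)
        obtain ⟨b, hb⟩ := Nat.exists_eq_add_of_le (hφ.id_le l)
        have hb' : φ l = l + b := hb
        have := inv_pow_sub_le hq hqp (s := l + 1) (a := a) (b := b) (by omega)
        rw [h3, div_eq_mul_one_div, div_eq_mul_one_div _ (p ^ (l + 1)), ← mul_sub,
          div_eq_mul_one_div _ (q ^ (φ l + 1)), div_eq_mul_one_div _ (p ^ (φ l + 1)), ← mul_sub,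
          mul_left_comm, show φ l + 1 = l + 1 + b by omega]
        gcongr
    _ = ∑ s ∈ (Finset.range n).image φ, p ^ a * (((c s : ℕ) : ℝ) / q ^ (s + 1)
        - ((c s : ℕ) : ℝ) / p ^ (s + 1)) :=
        (Finset.sum_image (f := fun s => p ^ a * (((c s : ℕ) : ℝ) / q ^ (s + 1)
          - ((c s : ℕ) : ℝ) / p ^ (s + 1))) fun x _ y _ hxy => hφ.injective hxy).symm
    _ ≤ _ := by
        refine Finset.sum_le_sum_of_subset_of_nonneg (fun s hs => ?_) (fun s _ _ => ?_)
        · obtain ⟨l, hl, rfl⟩ := Finset.mem_image.1 hs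
          exact Finset.mem_range.2 (h l (Finset.mem_range.1 hl)).1
        · rw [div_eq_mul_one_div, div_eq_mul_one_div _ (p ^ (s + 1)), ← mul_sub]
          exact mul_nonneg (by positivity) (mul_nonneg (by positivity) (key _))

theorem pow_succ_sub_pow_succ_le {x y r : ℝ} (hy : 0 ≤ y) (hyx : y ≤ x) (hx : x ≤ r) (s : ℕ) :
    x ^ (s + 1) - y ^ (s + 1) ≤ (s + 1) * r ^ s * (x - y) := by
  have hr : 0 ≤ r := by linarith
  induction s with
  | zero => simp
  | succ s ih =>
    have h1 : x ^ (s + 2) - y ^ (s + 2) = x * (x ^ (s + 1) - y ^ (s + 1)) + y ^ (s + 1) * (x - y) := by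
      ring
    have h2 : x * (x ^ (s + 1) - y ^ (s + 1)) ≤ r * ((s + 1) * r ^ s * (x - y)) := by
      have : 0 ≤ x ^ (s + 1) - y ^ (s + 1) := by
        rw [sub_nonneg]
        gcongr
      gcongr
    have h3 : y ^ (s + 1) * (x - y) ≤ r ^ (s + 1) * (x - y) := by
      have : 0 ≤ x - y := by linarith
      gcongr
      linarith
    push_cast
    rw [show s + 1 + 1 = s + 2 from rfl, h1]
    calc _ ≤ r * ((s + 1) * r ^ s * (x - y)) + r ^ (s + 1) * (x - y) := add_le_add h2 h3
      _ = _ := by ring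

/-- The constant 9 is the sum of (s + 1)(2/3)^s over s ≥ 0. -/
theorem partialVal_sub_le_nine_mul {p q : ℝ} (hq : 3 / 2 ≤ q) (hqp : q ≤ p) (c : ℕ → Fin 2)
    (n : ℕ) : partialVal q c n - partialVal p c n ≤ 9 * (1 / q - 1 / p) := by
  have hq0 : (0 : ℝ) < q := by linarith
  have hp0 : (0 : ℝ) < p := by linarith
  have hx : 1 / q ≤ 2 / 3 := by
    rw [div_le_div_iff₀ hq0 (by norm_num)]
    linarith
  have hyx : 1 / p ≤ 1 / q := by gcongr
  have hy : 0 ≤ 1 / p := by positivity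
  have hsum : ∀ n : ℕ, ∑ s ∈ Finset.range n, ((s : ℝ) + 1) * (2 / 3) ^ s
      = 9 - (3 * n + 9) * (2 / 3) ^ n := by
    intro n
    induction n with
    | zero => simp
    | succ n ih =>
      rw [Finset.sum_range_succ, ih]
      push_cast
      ring
  calc partialVal q c n - partialVal p c n
      ≤ ∑ s ∈ Finset.range n, ((s : ℝ) + 1) * (2 / 3) ^ s * (1 / q - 1 / p) := by
        simp only [partialVal, ← Finset.sum_sub_distrib]
        refine Finset.sum_le_sum fun s _ => ?_
        refine le_trans ?_ (pow_succ_sub_pow_succ_le hy hyx hx s)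
        have h0 : 0 ≤ (1 / q) ^ (s + 1) - (1 / p) ^ (s + 1) := by
          rw [sub_nonneg]
          gcongr
        rcases fin_two_cases (c s) with h | h
        · simpa [h] using h0
        · simp [h]
    _ = (9 - (3 * n + 9) * (2 / 3) ^ n) * (1 / q - 1 / p) := by
        rw [← Finset.sum_mul, hsum]
    _ ≤ 9 * (1 / q - 1 / p) := by
        have : 0 ≤ 1 / q - 1 / p := by linarith
        gcongr
        have : (0 : ℝ) ≤ (3 * n + 9) * (2 / 3) ^ n := by positivity
        linarith

/-- In base p the first G digits miss 1 by the tail; a sum still below 1 in base q has gained less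
than that. -/
theorem partialVal_thueMorse_sub_lt {q : ℝ} {G : ℕ}
    (h : partialVal q (drop 1 thueMorse) G < 1) :
    partialVal q (drop 1 thueMorse) G - partialVal qKL (drop 1 thueMorse) G <
      val qKL (drop (1 + G) thueMorse) / qKL ^ G := by
  have := val_eq_partialVal_add one_lt_qKL (drop 1 thueMorse) G
  rw [val_qKL_drop_one, drop_drop] at this
  linarith

/-! ### Glued sequences and the absence of smaller univoque bases. -/

/-- The Thue-Morse digits with indices in `[2 ^ k, 2 ^ n)`, followed by `t`. -/
def glue (k n : ℕ) (t : ℕ → Fin 2) : ℕ → Fin 2 := fun i =>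
  if i < 2 ^ n - 2 ^ k then thueMorse (2 ^ k + i) else t (i - (2 ^ n - 2 ^ k))

theorem glue_of_lt {k n i : ℕ} (h : i < 2 ^ n - 2 ^ k) (t : ℕ → Fin 2) :
    glue k n t i = thueMorse (2 ^ k + i) := if_pos h

theorem glue_add (k n i : ℕ) (t : ℕ → Fin 2) : glue k n t (2 ^ n - 2 ^ k + i) = t i := by
  rw [glue, if_neg (by omega), Nat.add_sub_cancel_left]

/-- Agreement with τ extends one place past the block, because τ_{2^n} and t 0 are both 1. -/
theorem glue_of_le {k n i : ℕ} (hkn : k ≤ n) (h : i ≤ 2 ^ n - 2 ^ k) {t : ℕ → Fin 2}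
    (ht : t 0 = 1) : glue k n t i = thueMorse (2 ^ k + i) := by
  have := Nat.pow_le_pow_right (n := 2) (by norm_num) hkn
  rcases h.lt_or_eq with h | rfl
  · exact glue_of_lt h t
  · rw [Nat.add_sub_cancel' this, thueMorse_two_pow, ← ht]
    exact glue_add k n 0 t

theorem drop_glue_add (k n i : ℕ) (t : ℕ → Fin 2) :
    drop (2 ^ n - 2 ^ k + i) (glue k n t) = drop i t := by
  funext l
  rw [drop, add_assoc, glue_add, drop]

theorem val_drop_glue {q : ℝ} (hq : 1 < q) {k n i r : ℕ} (h : i + r = 2 ^ n - 2 ^ k)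
    (t : ℕ → Fin 2) : val q (drop i (glue k n t)) = blockVal q (2 ^ k + i) r (val q t) := by
  rw [val_eq_partialVal_add hq _ r, drop_drop, h, blockVal]
  have h1 := drop_glue_add k n 0 t
  rw [add_zero] at h1
  rw [h1]
  congr 1
  · refine partialVal_congr fun l hl => ?_
    rw [drop, drop, glue_of_lt (by omega), add_assoc]
  · rw [show drop 0 t = t from by funext l; simp [drop]]

theorem drop_zero (d : ℕ → Fin 2) : drop 0 d = d := by
  funext l
  simp [drop]

theorem val_glue {q : ℝ} (hq : 1 < q) (k n : ℕ) (t : ℕ → Fin 2) :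
    val q (glue k n t) = blockVal q (2 ^ k) (2 ^ n - 2 ^ k) (val q t) := by
  have := val_drop_glue hq (k := k) (n := n) (i := 0) (zero_add _) t
  rwa [drop_zero] at this

theorem tailVal_eq_blockVal {k n : ℕ} (hkn : k ≤ n) :
    tailVal k = blockVal qKL (2 ^ k) (2 ^ n - 2 ^ k) (tailVal n) := by
  rw [tailVal, val_drop_thueMorse one_lt_qKL _ (2 ^ n - 2 ^ k),
    Nat.add_sub_cancel' (Nat.pow_le_pow_right (by norm_num) hkn), tailVal]

theorem blockVal_eq_tailVal_sub {k n : ℕ} (hkn : k ≤ n) (T : ℝ) :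
    blockVal qKL (2 ^ k) (2 ^ n - 2 ^ k) T =
      tailVal k - (tailVal n - T) / qKL ^ (2 ^ n - 2 ^ k) := by
  rw [tailVal_eq_blockVal hkn, blockVal, blockVal]
  ring

theorem three_halves_lt_of_partialVal_lt_one {q : ℝ} (hq : 1 < q) {G : ℕ} (hG : 2 ≤ G)
    (h : partialVal q (drop 1 thueMorse) G < 1) : 3 / 2 < q := by
  have hq0 : (0 : ℝ) < q := by linarith
  obtain ⟨m, rfl⟩ := Nat.exists_eq_add_of_le hG
  rw [partialVal_add hq] at h
  have h1 : 0 ≤ partialVal q (drop 2 (drop 1 thueMorse)) m / q ^ 2 :=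
    div_nonneg (partialVal_nonneg hq _ _) (by positivity)
  have h2 : partialVal q (drop 1 thueMorse) 2 = 1 / q + 1 / q ^ 2 := by
    have h2 : thueMorse 2 = 1 := thueMorse_two_pow 1
    simp [partialVal, Finset.sum_range_succ, drop, thueMorse_one, h2]
  by_contra! hle
  have h3 : (2 : ℝ) / 3 ≤ 1 / q := by
    rw [div_le_div_iff₀ (by norm_num) hq0]
    linarith
  have h4 : 1 / q ^ 2 = (1 / q) ^ 2 := by rw [div_pow, one_pow]
  nlinarith

theorem div_pow_eq_mul {p : ℝ} (hp : p ≠ 0) {G a b : ℕ} (h : G = a + b) (x : ℝ) :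
    x / p ^ b = p ^ a * (x / p ^ G) := by
  rw [h, pow_add]
  field_simp

/-- For a full tail of τ, `partialVal_sub_le` and `partialVal_thueMorse_sub_lt` would suffice. The
continuation T may be smaller than `tailVal n`; since k ≥ 1, the digit τ_1 is among those deleted,
and its variation 1/q - 1/p is available to pay for the difference. -/
theorem partialVal_le_blockVal {k n j i : ℕ} (hk : 1 ≤ k) (hn : 4 ≤ n)
    (hG : 2 ^ (j + 1) = 2 ^ k + i) (hGn : 2 ^ k + i ≤ 2 ^ n) {T : ℝ} (hT : tailLim ≤ T)
    {q : ℝ} (hq : 1 < q) (hqp : q < qKL)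
    (hU : partialVal q (drop 1 thueMorse) (2 ^ (j + 1)) < 1) :
    partialVal q (drop (2 ^ k) thueMorse) (i + 1) ≤
      blockVal qKL (2 ^ k) (2 ^ n - 2 ^ k) T := by
  have hp := one_lt_qKL
  have hq0 : (0 : ℝ) < q := by linarith
  have hp0 : (0 : ℝ) < qKL := by linarith
  have hp1 : (0 : ℝ) < qKL - 1 := by linarith
  have hp2 := qKL_lt
  have hp3 := qKL_ge
  have hkn : k ≤ n := (Nat.pow_le_pow_iff_right (a := 2) (by norm_num)).1 (by omega)
  have hk2 : 2 ≤ 2 ^ k := by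
    calc 2 = 2 ^ 1 := rfl
      _ ≤ 2 ^ k := Nat.pow_le_pow_right (by norm_num) hk
  rw [hG] at hU
  have hUd := partialVal_thueMorse_sub_lt hU
  have hq32 := three_halves_lt_of_partialVal_lt_one hq (by omega) hU
  have hnine := partialVal_sub_le_nine_mul hq32.le hqp.le (drop 1 thueMorse) (2 ^ k + i)
  rw [blockVal_eq_tailVal_sub hkn]
  -- the Thue-Morse digits with the first one replaced by `0`
  let c : ℕ → Fin 2 := fun s => if s = 0 then 0 else thueMorse (1 + s)
  have hc : ∀ x : ℝ, 1 < x → partialVal x (drop 1 thueMorse) (2 ^ k + i) =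
      partialVal x c (2 ^ k + i) + 1 / x := by
    intro x hx
    rw [show 2 ^ k + i = 1 + (2 ^ k + i - 1) by omega, partialVal_add hx, partialVal_add hx c]
    have h1 : drop 1 c = drop 1 (drop 1 thueMorse) := by
      funext s
      simp [drop, c]
    rw [h1]
    have h2 : partialVal x (drop 1 thueMorse) 1 = 1 / x := by
      simp [partialVal, drop, thueMorse_one]
    have h3 : partialVal x c 1 = 0 := by simp [partialVal, c]
    rw [h2, h3]
    ring
  have hF := partialVal_sub_le hq hqp.le (c := c) (d := drop (2 ^ k) thueMorse) (n := i + 1)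
    (G := 2 ^ k + i) (a := 2 ^ k - 1) (fun l => 2 ^ k - 1 + l)
    (fun x y hxy => by dsimp only; omega) (fun l hl => by
      refine ⟨by omega, by omega, ?_⟩
      simp only [drop, c]
      rw [if_neg (by omega)]
      congr 1
      omega)
  have htail : tailVal k = partialVal qKL (drop (2 ^ k) thueMorse) (i + 1) +
      val qKL (drop (1 + (2 ^ k + i)) thueMorse) / qKL ^ (i + 1) := by
    rw [tailVal, val_eq_partialVal_add hp _ (i + 1), drop_drop]
    congr 3
    congr 1
    omega
  have hX : (1 : ℝ) / 5 ≤ val qKL (drop (1 + (2 ^ k + i)) thueMorse) := by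
    refine le_trans ?_ (lt_val_drop_thueMorse (by omega)).le
    rw [le_sub_iff_add_le, le_div_iff₀ hp1]
    linarith
  have hη := tailVal_sub_tailLim_le (j := n) (by omega)
  have hR : (200 : ℝ) ≤ qKL ^ 2 ^ n := by
    calc (200 : ℝ) ≤ (8 / 5) ^ 16 := by norm_num
      _ ≤ qKL ^ 16 := by gcongr
      _ ≤ qKL ^ 2 ^ n := pow_le_pow_right₀ hp.le (by
        calc 16 = 2 ^ 4 := by norm_num
          _ ≤ 2 ^ n := Nat.pow_le_pow_right (by norm_num) hn)
  have hGR : qKL ^ (2 ^ k + i) ≤ qKL ^ 2 ^ n := pow_le_pow_right₀ hp.le hGn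
  have hGpos : 0 < qKL ^ (2 ^ k + i) := by positivity
  have hcq := hc q hq
  have hcp := hc qKL hp
  set X := val qKL (drop (1 + (2 ^ k + i)) thueMorse)
  set η := tailVal n - T with hηdef
  have e1 : X / qKL ^ (i + 1) = qKL ^ (2 ^ k - 1) * (X / qKL ^ (2 ^ k + i)) :=
    div_pow_eq_mul hp0.ne' (by omega) X
  have e2 : η / qKL ^ (2 ^ n - 2 ^ k) = qKL ^ (2 ^ k - 1) * (qKL * η / qKL ^ 2 ^ n) := by
    have hpow : qKL ^ 2 ^ n = qKL ^ (2 ^ k - 1) * qKL ^ (2 ^ n - 2 ^ k) * qKL := by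
      rw [← pow_add, ← pow_succ]
      congr 1
      omega
    rw [hpow]
    field_simp
  set Ud := partialVal q (drop 1 thueMorse) (2 ^ k + i) -
    partialVal qKL (drop 1 thueMorse) (2 ^ k + i) with hUddef
  have hmain : Ud - (1 / q - 1 / qKL) + qKL * η / qKL ^ 2 ^ n ≤ X / qKL ^ (2 ^ k + i) := by
    set R := qKL ^ 2 ^ n
    -- Either the saved 1/q - 1/p covers the loss, or q is so close to p that the crude bound 9 (1/q
    -- - 1/p) on the variation is enough.
    rcases le_or_gt (qKL * η / R) (1 / q - 1 / qKL) with h | h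
    · linarith
    · have h1 : qKL * η / R ≤ 2 * (2 / R) / R := by
        have h3 : η ≤ 2 / R := by linarith
        have h4 : 0 < 2 / R := by positivity
        have : qKL * η ≤ 2 * (2 / R) := by nlinarith
        gcongr
      have h2 : (1 / 5) / R ≤ X / qKL ^ (2 ^ k + i) := by gcongr
      -- This needs R ≥ 200, the reason for 4 ≤ n.
      have h3 : 10 * (2 * (2 / R) / R) ≤ (1 / 5) / R := by
        rw [show 10 * (2 * (2 / R) / R) = (40 / R) / R by ring]
        have h5 : 40 / R ≤ 1 / 5 := by
          rw [div_le_div_iff₀ (by linarith) (by norm_num)]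
          linarith
        gcongr
      have h4 : 1 / qKL < 1 / q := by gcongr
      linarith
  have hN : 0 < qKL ^ (2 ^ k - 1) := by positivity
  have hmul := mul_le_mul_of_nonneg_left hmain hN.le
  have e3 : partialVal q c (2 ^ k + i) - partialVal qKL c (2 ^ k + i) =
      Ud - (1 / q - 1 / qKL) := by
    rw [hUddef, hcq, hcp]
    ring
  rw [e3] at hF
  rw [htail, e1, e2]
  linarith

theorem exists_eq_two_pow_add {L : ℕ} (hL : 2 ≤ L) :
    ∃ j r, L = 2 ^ j + 1 + r ∧ 1 + r ≤ 2 ^ j := by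
  have h1 := Nat.pow_log_le_self 2 (x := L - 1) (by omega)
  have h2 := Nat.lt_pow_succ_log_self (b := 2) (by norm_num) (L - 1)
  rw [pow_succ] at h2
  exact ⟨Nat.log 2 (L - 1), L - 1 - 2 ^ Nat.log 2 (L - 1), by omega, by omega⟩

theorem thueMorse_eq_zero_of_two_pow_add {j r : ℕ} (hr : 1 + r < 2 ^ j)
    (h : thueMorse (2 ^ j + 1 + r) = 1) : thueMorse (1 + r) = 0 := by
  rw [add_assoc, thueMorse_two_pow_add j _ hr] at h
  rcases fin_two_cases (thueMorse (1 + r)) with h1 | h1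
  · exact h1
  · rw [h1] at h
    exact absurd h (by decide)

theorem qKL_le_of_mem_univoqueBases_glue {k n : ℕ} (hk : 1 ≤ k) (hkn : k ≤ n) (hn : 4 ≤ n)
    {t : ℕ → Fin 2} (ht0 : t 0 = 1) (hT1 : tailLim ≤ val qKL t) (hT2 : val qKL t ≤ tailVal n)
    (hub : ∀ i, val qKL (drop (i + 1) t) ≤ 1)
    (H : ∀ i, 1 ≤ i → t i = 1 → ∃ l r, l + 1 + r = i ∧ t l = 1 ∧
      (∀ s < r, t (l + 1 + s) = 1 - thueMorse (1 + s)) ∧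
      (thueMorse (1 + r) = 0 ∨ ∃ j, 1 + r = 2 ^ j ∧ ∀ q, 1 < q → q < qKL →
        partialVal q (drop 1 thueMorse) (2 ^ (j + 1)) < 1 →
          partialVal q (glue k n t) (2 ^ n - 2 ^ k + i + 1) ≤ val qKL (glue k n t)))
    {q : ℝ} (hmem : q ∈ univoqueBases (val qKL (glue k n t))) : qKL ≤ q := by
  have hp := one_lt_qKL
  have hp0 : (0 : ℝ) < qKL := by linarith
  have hp1 : (0 : ℝ) < qKL - 1 := by linarith
  have hpow := Nat.pow_le_pow_right (n := 2) (by norm_num) hkn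
  have hk2 : 2 ≤ 2 ^ k := by
    calc 2 = 2 ^ 1 := rfl
      _ ≤ 2 ^ k := Nat.pow_le_pow_right (by norm_num) hk
  refine qKL_le_of_mem_univoqueBases (d := glue k n t) ?_ ?_ ?_ ?_ hmem
  · rw [glue_of_le hkn (Nat.zero_le _) ht0, add_zero, thueMorse_two_pow]
  · rcases Nat.eq_zero_or_pos (2 ^ n - 2 ^ k) with h | h
    · have h1 := drop_glue_add k n 1 t
      rw [h, zero_add] at h1
      rw [h1]
      rw [val_eq_head_add hp, ht0, tailLim_eq, le_div_iff₀ hp0] at hT1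
      have h2 : (1 / (qKL - 1) - 1 / qKL) * qKL = 1 / (qKL - 1) := by
        field_simp
        ring
      simp only [Fin.val_one, Nat.cast_one] at hT1
      linarith
    · rw [val_drop_glue hp (r := 2 ^ n - 2 ^ k - 1) (by omega)]
      exact (lt_blockVal (j := n) (by omega) (by omega)
        (inv_qKL_lt_tailLim.le.trans hT1)).le
  · intro i
    rcases le_or_gt (i + 1) (2 ^ n - 2 ^ k) with h | h
    · rw [val_drop_glue hp (r := 2 ^ n - 2 ^ k - (i + 1)) (by omega)]
      exact (blockVal_lt_one (j := n) (by omega) (by omega) hT2).le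
    · obtain ⟨l, hl⟩ := Nat.exists_eq_add_of_lt h
      rw [hl, add_assoc, drop_glue_add]
      exact hub l
  · intro i hi hd
    rcases le_or_gt i (2 ^ n - 2 ^ k) with h | h
    -- The stretch starts at the last power of 2 strictly before the index 2^k + i. The digit 1 at
    -- its end forces τ_{1+r} = 0 unless that index is itself a power of 2.
    · obtain ⟨j, r, hL, hr⟩ := exists_eq_two_pow_add (L := 2 ^ k + i) (by omega)
      have hkj : k ≤ j := by
        have : 2 ^ k < 2 ^ (j + 1) := by rw [pow_succ]; omega
        have := (Nat.pow_lt_pow_iff_right (a := 2) (by norm_num)).1 this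
        omega
      have hpowj := Nat.pow_le_pow_right (n := 2) (by norm_num) hkj
      refine ⟨2 ^ j - 2 ^ k, r, by omega, ?_, fun s hs => ?_, ?_⟩
      · rw [glue_of_le hkn (by omega) ht0, Nat.add_sub_cancel' hpowj, thueMorse_two_pow]
      · rw [glue_of_le hkn (by omega) ht0, ← thueMorse_two_pow_add j _ (by omega)]
        congr 1
        omega
      · rcases hr.lt_or_eq with hr | hr
        · left
          rw [glue_of_le hkn h ht0, hL] at hd
          exact thueMorse_eq_zero_of_two_pow_add hr hd
        · right
          refine ⟨j, hr, fun q hq hqp hU => ?_⟩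
          have hG : 2 ^ (j + 1) = 2 ^ k + i := by rw [pow_succ]; omega
          rw [partialVal_congr (e := drop (2 ^ k) thueMorse)
            fun l hl => glue_of_le hkn (by omega) ht0, val_glue hp]
          exact partialVal_le_blockVal hk hn hG (by omega) hT1 hq hqp hU
    · obtain ⟨m, rfl⟩ := Nat.exists_eq_add_of_le h.le
      rw [glue_add] at hd
      obtain ⟨l, r, h1, h2, h3, h4⟩ := H m (by omega) hd
      refine ⟨2 ^ n - 2 ^ k + l, r, by omega, by rw [glue_add, h2], fun s hs => ?_, h4⟩
      rw [← h3 s hs, ← glue_add k n _ t]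
      congr 1
      omega

/-- The sequence is τ_1τ_2… without the indices in [1, 2^k) and [2^n, 2^m). Past the prefix it
coincides with τ shifted by the maximal amount, so the comparison is exact and needs no slack. -/
theorem partialVal_glue_le {k n m i j : ℕ} (hkn : k ≤ n) (hnm : n ≤ m)
    (hG : 2 ^ (j + 1) = 2 ^ m + i) {q : ℝ} (hq : 1 < q) (hqp : q < qKL)
    (hU : partialVal q (drop 1 thueMorse) (2 ^ (j + 1)) < 1) :
    partialVal q (glue k n (drop (2 ^ m) thueMorse)) (2 ^ n - 2 ^ k + i + 1) ≤
      val qKL (glue k n (drop (2 ^ m) thueMorse)) := by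
  have hp := one_lt_qKL
  have hp0 : (0 : ℝ) < qKL := by linarith
  have hpow := Nat.pow_le_pow_right (n := 2) (by norm_num) hkn
  have hpow' := Nat.pow_le_pow_right (n := 2) (by norm_num) hnm
  have hkpos : 0 < 2 ^ k := by positivity
  rw [hG] at hU
  have hUd := partialVal_thueMorse_sub_lt hU
  set c := 2 ^ n - 2 ^ k with hc
  have hF := partialVal_sub_le hq hqp.le (c := drop 1 thueMorse)
    (d := glue k n (drop (2 ^ m) thueMorse)) (n := c + i + 1)
    (G := 2 ^ m + i) (a := 2 ^ m - 1 - c)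
    (fun x => if x < c then 2 ^ k - 1 + x else 2 ^ m - 1 + (x - c))
    (fun x y hxy => by
      change (if x < c then _ else _) < (if y < c then _ else _)
      split_ifs <;> omega)
    (fun x hx => by
      split_ifs with h
      · refine ⟨by omega, by omega, ?_⟩
        rw [glue_of_lt h, drop]
        congr 1
        omega
      · refine ⟨by omega, by omega, ?_⟩
        obtain ⟨y, rfl⟩ := Nat.exists_eq_add_of_le (not_lt.1 h)
        rw [hc, glue_add, drop, drop]
        congr 1
        omega)
  have hv := val_eq_partialVal_add hp (glue k n (drop (2 ^ m) thueMorse)) (c + i + 1)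
  have hdrop : drop (c + i + 1) (glue k n (drop (2 ^ m) thueMorse)) =
      drop (1 + (2 ^ m + i)) thueMorse := by
    rw [hc, add_assoc, drop_glue_add, drop_drop]
    congr 1
    omega
  rw [hdrop] at hv
  have e1 : val qKL (drop (1 + (2 ^ m + i)) thueMorse) / qKL ^ (c + i + 1) =
      qKL ^ (2 ^ m - 1 - c) *
        (val qKL (drop (1 + (2 ^ m + i)) thueMorse) / qKL ^ (2 ^ m + i)) :=
    div_pow_eq_mul hp0.ne' (by omega) _
  have hN : 0 < qKL ^ (2 ^ m - 1 - c) := by positivity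
  have hmul := mul_le_mul_of_nonneg_left hUd.le hN.le
  rw [hv, e1]
  linarith

theorem qKL_le_of_mem_thueMorse_glue {k n m : ℕ} (hk : 1 ≤ k) (hkn : k ≤ n) (hn : 4 ≤ n)
    (hnm : n ≤ m) {q : ℝ}
    (hmem : q ∈ univoqueBases (val qKL (glue k n (drop (2 ^ m) thueMorse)))) : qKL ≤ q := by
  refine qKL_le_of_mem_univoqueBases_glue hk hkn hn (thueMorse_two_pow m)
    (tailLim_lt_tailVal m).le (tailVal_strictAnti.antitone hnm) (fun i => ?_) ?_ hmem
  · rw [drop_drop]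
    exact val_drop_thueMorse_le_one (Nat.le_add_left_of_le (by omega))
  · intro i hi hd
    have hmpos : 0 < 2 ^ m := by positivity
    obtain ⟨j, r, hL, hr⟩ := exists_eq_two_pow_add (L := 2 ^ m + i) (by omega)
    have hmj : m ≤ j := by
      have : 2 ^ m < 2 ^ (j + 1) := by rw [pow_succ]; omega
      have := (Nat.pow_lt_pow_iff_right (a := 2) (by norm_num)).1 this
      omega
    have hpowj := Nat.pow_le_pow_right (n := 2) (by norm_num) hmj
    refine ⟨2 ^ j - 2 ^ m, r, by omega, ?_, fun s hs => ?_, ?_⟩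
    · rw [drop, Nat.add_sub_cancel' hpowj, thueMorse_two_pow]
    · rw [drop, ← thueMorse_two_pow_add j _ (by omega)]
      congr 1
      omega
    · rcases hr.lt_or_eq with hr | hr
      · left
        rw [drop, hL] at hd
        exact thueMorse_eq_zero_of_two_pow_add hr hd
      · right
        exact ⟨j, hr, fun q hq hqp hU => partialVal_glue_le hkn hnm
          (by rw [pow_succ]; omega) hq hqp hU⟩

theorem qKL_le_of_mem_compl_glue {k n : ℕ} (hk : 1 ≤ k) (hkn : k ≤ n) (hn : 4 ≤ n) {q : ℝ}
    (hmem : q ∈ univoqueBases (val qKL (glue k n (compl thueMorse)))) : qKL ≤ q := by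
  refine qKL_le_of_mem_univoqueBases_glue hk hkn hn (by simp [compl, thueMorse_zero])
    le_rfl (tailLim_lt_tailVal n).le (fun i => ?_) ?_ hmem
  · rw [drop_compl, val_compl one_lt_qKL]
    linarith [lt_val_drop_thueMorse (a := i + 1) (by omega)]
  · intro i hi hd
    obtain ⟨r, rfl⟩ := Nat.exists_eq_add_of_le hi
    -- The complement of τ is itself a 1 followed by complemented digits of τ, so l = 0 always
    -- serves and the power-of-2 alternative never arises.
    refine ⟨0, r, by omega, by simp [compl, thueMorse_zero], fun s _ => ?_, Or.inl ?_⟩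
    · rw [zero_add, compl]
    · rcases fin_two_cases (thueMorse (1 + r)) with h1 | h1
      · exact h1
      · rw [compl, h1] at hd
        exact absurd hd (by decide)

/-! ### Membership in the level set. -/

theorem admissible_glue {k n m : ℕ} (hk : 1 ≤ k) (hkn : k ≤ n) (hnm : n ≤ m) :
    Admissible qKL (glue k n (drop (2 ^ m) thueMorse)) := by
  have hp := one_lt_qKL
  have hpow := Nat.pow_le_pow_right (n := 2) (by norm_num) hkn
  have hk2 : 2 ≤ 2 ^ k := by
    calc 2 = 2 ^ 1 := rfl
      _ ≤ 2 ^ k := Nat.pow_le_pow_right (by norm_num) hk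
  have hm : 2 ^ n ≤ 2 ^ m := Nat.pow_le_pow_right (by norm_num) hnm
  have key : ∀ i, 1 / (qKL - 1) - 1 < val qKL (drop (i + 1) (glue k n (drop (2 ^ m) thueMorse)))
      ∧ val qKL (drop (i + 1) (glue k n (drop (2 ^ m) thueMorse))) < 1 := by
    intro i
    rcases le_or_gt (i + 1) (2 ^ n - 2 ^ k) with h | h
    · rw [val_drop_glue hp (r := 2 ^ n - 2 ^ k - (i + 1)) (by omega)]
      exact ⟨lt_blockVal (j := n) (by omega) (by omega) (inv_lt_tailVal m).le,
        blockVal_lt_one (j := n) (by omega) (by omega) (tailVal_strictAnti.antitone hnm)⟩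
    · obtain ⟨l, hl⟩ := Nat.exists_eq_add_of_lt h
      rw [hl, add_assoc, drop_glue_add, drop_drop]
      exact ⟨lt_val_drop_thueMorse (by omega), val_drop_thueMorse_lt_one (by omega)⟩
  refine fun i => ⟨fun _ => (key i).2, fun _ => ?_⟩
  rw [val_compl hp]
  linarith [(key i).1]

theorem isLeast_univoqueBases_glue {k n m : ℕ} (hk : 1 ≤ k) (hkn : k ≤ n) (hn : 4 ≤ n)
    (hnm : n ≤ m) :
    IsLeast (univoqueBases (val qKL (glue k n (drop (2 ^ m) thueMorse)))) qKL :=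
  ⟨mem_univoqueBases_iff.2 ⟨one_lt_qKL, qKL_lt_two.le, _, rfl, admissible_glue hk hkn hnm⟩,
    fun _ hq => qKL_le_of_mem_thueMorse_glue hk hkn hn hnm hq⟩

theorem val_glue_pos {k n : ℕ} (hkn : k ≤ n) {t : ℕ → Fin 2} (ht0 : t 0 = 1) :
    0 < val qKL (glue k n t) := by
  have hp := one_lt_qKL
  have hp0 : 0 < qKL := by linarith
  rw [val_eq_head_add hp, glue_of_le hkn (Nat.zero_le _) ht0, add_zero, thueMorse_two_pow]
  have := val_nonneg hp (drop 1 (glue k n t))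
  simp only [Fin.val_one, Nat.cast_one]
  positivity

theorem val_glue_mem_levelSet {k n m : ℕ} (hk : 1 ≤ k) (hkn : k ≤ n) (hn : 4 ≤ n)
    (hnm : n ≤ m) : val qKL (glue k n (drop (2 ^ m) thueMorse)) ∈ levelSet qKL :=
  ⟨val_glue_pos hkn (thueMorse_two_pow m), (isLeast_univoqueBases_glue hk hkn hn hnm).csInf_eq⟩

theorem val_glue_thueMorse {k n : ℕ} (hkn : k ≤ n) (m : ℕ) :
    val qKL (glue k n (drop (2 ^ m) thueMorse)) =
      tailVal k - (tailVal n - tailVal m) / qKL ^ (2 ^ n - 2 ^ k) := by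
  rw [val_glue one_lt_qKL, blockVal_eq_tailVal_sub hkn, tailVal, tailVal, tailVal]

theorem val_glue_compl {k n : ℕ} (hkn : k ≤ n) :
    val qKL (glue k n (compl thueMorse)) =
      tailVal k - (tailVal n - tailLim) / qKL ^ (2 ^ n - 2 ^ k) := by
  rw [val_glue one_lt_qKL, blockVal_eq_tailVal_sub hkn, tailLim]

theorem exists_tailVal_sub_tailLim_lt {δ : ℝ} (hδ : 0 < δ) (N : ℕ) :
    ∃ m, N ≤ m ∧ tailVal m - tailLim < δ := by
  have hp := one_lt_qKL
  have hp0 : 0 < qKL := by linarith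
  obtain ⟨M, hM⟩ := exists_pow_lt_of_lt_one (half_pos hδ) (inv_lt_one_of_one_lt₀ hp)
  refine ⟨N + M + 1, by omega, (tailVal_sub_tailLim_le (by omega)).trans_lt ?_⟩
  have h1 : M ≤ 2 ^ (N + M + 1) := by
    have := Nat.lt_two_pow_self (n := N + M + 1)
    omega
  have h2 : 2 / qKL ^ 2 ^ (N + M + 1) ≤ 2 * qKL⁻¹ ^ M := by
    rw [inv_pow, ← div_eq_mul_inv]
    have := pow_le_pow_right₀ hp.le h1
    gcongr
  linarith

theorem exists_glue_near {k n : ℕ} (hkn : k ≤ n) {δ : ℝ} (hδ : 0 < δ) :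
    ∃ m, n ≤ m ∧ val qKL (glue k n (compl thueMorse)) <
        val qKL (glue k n (drop (2 ^ m) thueMorse)) ∧
      val qKL (glue k n (drop (2 ^ m) thueMorse)) <
        val qKL (glue k n (compl thueMorse)) + δ := by
  have hp := one_lt_qKL
  have hp0 : 0 < qKL := by linarith
  obtain ⟨m, hm, hlt⟩ := exists_tailVal_sub_tailLim_lt hδ n
  have hgt := tailLim_lt_tailVal m
  have h1 : 1 ≤ qKL ^ (2 ^ n - 2 ^ k) := one_le_pow₀ hp.le
  have h2 : (tailVal m - tailLim) / qKL ^ (2 ^ n - 2 ^ k) ≤ tailVal m - tailLim :=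
    div_le_self (by linarith) h1
  have h3 : 0 < (tailVal m - tailLim) / qKL ^ (2 ^ n - 2 ^ k) :=
    div_pos (by linarith) (by linarith)
  refine ⟨m, hm, ?_⟩
  rw [val_glue_thueMorse hkn, val_glue_compl hkn]
  rw [sub_div] at h2 h3 ⊢
  rw [sub_div]
  constructor <;> linarith

/-- For large m the sequence ending in the tail from 2^m has value slightly above x in base p and
below x in base r > p. In between it represents x, and it is still admissible there. -/
theorem exists_mem_univoqueBases_lt {k n : ℕ} (hk : 1 ≤ k) (hkn : k ≤ n) {ε : ℝ} (hε : 0 < ε) :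
    ∃ q ∈ univoqueBases (val qKL (glue k n (compl thueMorse))), q ≤ qKL + ε := by
  have hp := one_lt_qKL
  have hp0 : 0 < qKL := by linarith
  have hp2 := qKL_lt_two
  obtain ⟨r, hr1, hr2, hr3⟩ : ∃ r, qKL < r ∧ r ≤ 2 ∧ r ≤ qKL + ε :=
    ⟨min 2 (qKL + ε), lt_min hp2 (by linarith), min_le_left _ _, min_le_right _ _⟩
  have hδ : 0 < 1 / qKL - 1 / r := by
    rw [sub_pos]
    gcongr
  obtain ⟨m, hm, hlt, hgt⟩ := exists_glue_near hkn hδ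
  have h0 : glue k n (drop (2 ^ m) thueMorse) 0 = 1 := by
    rw [glue_of_le hkn (Nat.zero_le _) (thueMorse_two_pow m), add_zero, thueMorse_two_pow]
  have hval := val_lt_of_base_lt hp hr1 h0
  obtain ⟨q, hq, hqv⟩ := intermediate_value_Icc' hr1.le
    (continuousOn_val hp (glue k n (drop (2 ^ m) thueMorse)) r)
    (show val qKL (glue k n (compl thueMorse)) ∈ Set.Icc _ _ from ⟨by linarith, hlt.le⟩)
  exact ⟨q, mem_univoqueBases_iff.2 ⟨hp.trans_le hq.1, hq.2.trans hr2, _, hqv,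
    (admissible_glue hk hkn hm).mono hp hq.1⟩, hq.2.trans hr3⟩

theorem val_glue_compl_mem_levelSet {k n : ℕ} (hk : 1 ≤ k) (hkn : k ≤ n) (hn : 4 ≤ n) :
    val qKL (glue k n (compl thueMorse)) ∈ levelSet qKL := by
  have hlb : ∀ q ∈ univoqueBases (val qKL (glue k n (compl thueMorse))), qKL ≤ q :=
    fun q hq => qKL_le_of_mem_compl_glue hk hkn hn hq
  refine ⟨val_glue_pos hkn (by simp [compl, thueMorse_zero]), le_antisymm ?_ ?_⟩
  · refine le_of_forall_pos_le_add fun ε hε => ?_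
    obtain ⟨q, hq, hle⟩ := exists_mem_univoqueBases_lt hk hkn hε
    exact (csInf_le ⟨qKL, hlb⟩ hq).trans hle
  · obtain ⟨q, hq, -⟩ := exists_mem_univoqueBases_lt hk hkn one_pos
    exact le_csInf ⟨q, hq⟩ hlb

/-! ### Accumulation points and infinitude. -/

theorem isRightAccPt_val_glue_compl {k n : ℕ} (hk : 1 ≤ k) (hkn : k ≤ n) (hn : 4 ≤ n) :
    IsRightAccPt (val qKL (glue k n (compl thueMorse))) (levelSet qKL) := fun ε hε => by
  obtain ⟨m, hm, h⟩ := exists_glue_near hkn hε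
  exact ⟨_, val_glue_mem_levelSet hk hkn hn hm, h⟩

theorem isLeftAccPt_tailVal {k : ℕ} (hk : 1 ≤ k) :
    IsLeftAccPt (tailVal k) (levelSet qKL) := fun ε hε => by
  have hp := one_lt_qKL
  obtain ⟨n, hn, hlt⟩ := exists_tailVal_sub_tailLim_lt hε (k + 4)
  have hgt := tailLim_lt_tailVal n
  have hkn : k ≤ n := by omega
  refine ⟨_, val_glue_compl_mem_levelSet hk hkn (by omega), ?_⟩
  rw [val_glue_compl hkn]
  have h1 : 1 ≤ qKL ^ (2 ^ n - 2 ^ k) := one_le_pow₀ hp.le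
  have h2 : (tailVal n - tailLim) / qKL ^ (2 ^ n - 2 ^ k) ≤ tailVal n - tailLim :=
    div_le_self (by linarith) h1
  have h3 : 0 < (tailVal n - tailLim) / qKL ^ (2 ^ n - 2 ^ k) :=
    div_pos (by linarith) (by linarith)
  constructor <;> linarith

theorem tailVal_eq_val_glue (k : ℕ) :
    tailVal k = val qKL (glue k k (drop (2 ^ k) thueMorse)) := by
  rw [val_glue_thueMorse le_rfl]
  simp

theorem strictMono_val_glue_compl (k : ℕ) :
    StrictMono fun i => val qKL (glue k (i + k) (compl thueMorse)) := by
  have hp := one_lt_qKL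
  have hp0 : 0 < qKL := by linarith
  refine strictMono_nat_of_lt_succ fun i => ?_
  rw [val_glue_compl (by omega), val_glue_compl (by omega)]
  have h1 := tailVal_succ_lt (i + k)
  have h2 := tailLim_lt_tailVal (i + k + 1)
  have h3 : 2 ^ (i + k) - 2 ^ k ≤ 2 ^ (i + k + 1) - 2 ^ k := by
    have : 2 ^ (i + k) ≤ 2 ^ (i + k + 1) := Nat.pow_le_pow_right (by norm_num) (by omega)
    omega
  have h4 := pow_le_pow_right₀ hp.le h3
  have h5 : (tailVal (i + k + 1) - tailLim) / qKL ^ (2 ^ (i + k + 1) - 2 ^ k) ≤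
      (tailVal (i + k + 1) - tailLim) / qKL ^ (2 ^ (i + k) - 2 ^ k) := by
    have : 0 ≤ tailVal (i + k + 1) - tailLim := by linarith
    gcongr
  have h6 : (tailVal (i + k + 1) - tailLim) / qKL ^ (2 ^ (i + k) - 2 ^ k) <
      (tailVal (i + k) - tailLim) / qKL ^ (2 ^ (i + k) - 2 ^ k) := by gcongr
  rw [show i + 1 + k = i + k + 1 by ring]
  linarith

end UnivoqueBases

open UnivoqueBases

theorem theorem1p3 :
    {x : ℝ | 0 < x ∧ UnivoqueBases.qs x = UnivoqueBases.qKL ∧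
      IsLeast (UnivoqueBases.univoqueBases x) UnivoqueBases.qKL}.Infinite ∧
    {x : ℝ | x ∈ UnivoqueBases.levelSet UnivoqueBases.qKL ∧
      UnivoqueBases.IsRightAccPt x (UnivoqueBases.levelSet UnivoqueBases.qKL)}.Infinite ∧
    {x : ℝ | x ∈ UnivoqueBases.levelSet UnivoqueBases.qKL ∧
      UnivoqueBases.IsLeftAccPt x (UnivoqueBases.levelSet UnivoqueBases.qKL)}.Infinite := by
  -- `tailVal k` is the glued value with n = k, so the shift by 4 secures 4 ≤ n.
  have hinj : Function.Injective fun i => tailVal (i + 4) :=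
    tailVal_strictAnti.injective.comp (add_left_injective 4)
  refine ⟨Set.infinite_of_injective_forall_mem hinj fun i => ?_,
    Set.infinite_of_injective_forall_mem (strictMono_val_glue_compl 4).injective fun i =>
      ⟨val_glue_compl_mem_levelSet (by norm_num) (by omega) (by omega),
        isRightAccPt_val_glue_compl (by norm_num) (by omega) (by omega)⟩,
    Set.infinite_of_injective_forall_mem hinj fun i => ⟨?_, isLeftAccPt_tailVal (by omega)⟩⟩
  · have h := isLeast_univoqueBases_glue (k := i + 4) (n := i + 4) (m := i + 4) (by omega)
      le_rfl (by omega) le_rfl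
    have hpos := val_glue_pos (k := i + 4) le_rfl (t := drop (2 ^ (i + 4)) thueMorse)
      (thueMorse_two_pow _)
    rw [← tailVal_eq_val_glue] at h hpos
    exact ⟨hpos, h.csInf_eq, h⟩
  · rw [tailVal_eq_val_glue]
    exact val_glue_mem_levelSet (by omega) le_rfl (by omega) le_rfl
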